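/- Let $n\ge 0$ and let $Z=[z_0:\dots:z_n]$ be the homogeneous coordinates of $\mathbb{CP}^n$. For $k\in\mathbb Z$, sections of $\mathcal O(k)$ over an open set $U\subseteq\mathbb{CP}^n$ are the holomorphic functions on the preimage of $U$ in $\mathbb C^{n+1}\setminus\{0\}$ that are homogeneous of degree $k$. Let $\Lambda^{\alpha\beta}\in H^0(\mathbb{CP}^n,\mathcal O(2))$ $(0\le\alpha,\beta\le n)$, so that $\{f,g\}=\Lambda^{\alpha\beta}\,\partial_{Z_\alpha}f\,\partial_{Z_\beta}g$ (repeated indices are summed) is a holomorphic biderivation of order zero: it maps $\mathcal O(k)\times\mathcal O(l)$ to $\mathcal O(k+l)$, and in particular acts on $\mathcal O_{\mathbb{CP}^n}$. Assume that $\{\cdot,\cdot\}$ is skew-symmetric and satisfies the Jacobi rule on local sections of all the $\mathcal O(k)$, and that for all $r\ge 0$ $$f\,(\overleftarrow{\partial_{Z_{\alpha_1}}}\Lambda^{\alpha_1\beta_1}\overrightarrow{\partial_{Z_{\beta_1}}})\cdots(\overleftarrow{\partial_{Z_{\alpha_r}}}\Lambda^{\alpha_r\beta_r}\overrightarrow{\partial_{Z_{\beta_r}}})\,g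 =\Lambda^{\alpha_1\beta_1}\cdots\Lambda^{\alpha_r\beta_r}\;\partial_{Z_{\alpha_1}}\cdots\partial_{Z_{\alpha_r}}f\;\;\partial_{Z_{\beta_1}}\cdots\partial_{Z_{\beta_r}}g$$ for all local sections $f,g$ of the $\mathcal O(k)$, where on the left-hand side $\overleftarrow{\partial}$ (resp. $\overrightarrow{\partial}$) differentiates the product of all functions standing to its left (resp. right). Put $$f\#g=\sum_{r\ge 0}\frac1{r!}\Big(\frac\mu2\Big)^r\Lambda^{\alpha_1\beta_1}\cdots\Lambda^{\alpha_r\beta_r}\;\partial_{Z_{\alpha_1}}\cdots\partial_{Z_{\alpha_r}}f\;\;\partial_{Z_{\beta_1}}\cdots\partial_{Z_{\beta_r}}g .$$ For a complex vector space $M$ let $M[[\natural]]$ denote any one of the following: the Laurent polynomials in $\mu$ with coefficients in $M$, the Laurent series in $\mu^{-1}$ (finitely many positive powers of $\mu$), or the Laurent series in $\mu$ (finitely many negative powers of $\mu$). Then: 1. For each choice of $\natural$, the product $\#$, extended bilinearly and $\mu$-linearly, induces a globally defined product on $\bigoplus_{k\ge 0}H^0(\mathbb{CP}^n,\mathcal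 O(k))[[\natural]]$: each coefficient of $a\#b$ is a finite sum, the restriction of $a\# b$ to any open $U$ is given by the formula applied to $a|_U$ and $b|_U$, and degrees add. This product is associative and, if $\Lambda\ne 0$, non-commutative. 2. The parameter $\mu$ may be specialized to any scalar $c\in\mathbb C$ (for example $c=1$): the formula with $\mu=c$ is a finite sum on global sections and defines an associative product $\#_c$ on $\bigoplus_{k\ge 0}H^0(\mathbb{CP}^n,\mathcal O(k))$, which is non-commutative if $\Lambda\ne 0$ and $c\neq 0$. For $c\ne 0$ the substitution $\mu\mapsto c$ from $\bigoplus_k H^0(\mathbb{CP}^n,\mathcal O(k))[\mu,\mu^{-1}]$ to $\bigoplus_k H^0(\mathbb{CP}^n,\mathcal O(k))$ carries $\#$ to $\#_c$. -/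

import Mathlib

open TopologicalSpace
open scoped LinearAlgebra.Projectivization DirectSum

noncomputable section

namespace SymbolCalculus

/-- The space `ℂ^{n+1}` of homogeneous coordinates `Z = (z_0, …, z_n)`. -/
abbrev Coord (n : ℕ) : Type := Fin (n + 1) → ℂ

/-- Complex projective space: the lines in `ℂ^{n+1}`. -/
abbrev CP (n : ℕ) : Type := ℙ ℂ (Coord n)

/-- The quotient topology coming from `ℂ^{n+1} \ {0}`. -/
instance instTopologicalSpaceCP (n : ℕ) : TopologicalSpace (CP n) :=
  TopologicalSpace.coinduced (fun v : {v : Coord n // v ≠ 0} => Projectivization.mk' ℂ v)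
    inferInstance

/-- The preimage of `U ⊆ ℂP^n` in `ℂ^{n+1} \ {0}`. -/
def cone {n : ℕ} (U : Opens (CP n)) : Set (Coord n) :=
  {z | ∃ h : z ≠ 0, Projectivization.mk ℂ z h ∈ U}

theorem isOpen_cone {n : ℕ} (U : Opens (CP n)) : IsOpen (cone U) := by
  have h1 : IsOpen {v : {v : Coord n // v ≠ 0} | Projectivization.mk' ℂ v ∈ U} :=
    isOpen_coinduced.1 U.isOpen
  have h2 : IsOpen {v : Coord n | v ≠ 0} := isOpen_ne
  have h3 := h2.isOpenMap_subtype_val _ h1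
  convert h3 using 1
  ext z
  constructor
  · rintro ⟨h, hz⟩
    exact ⟨⟨z, h⟩, hz, rfl⟩
  · rintro ⟨v, hv, rfl⟩
    exact ⟨v.2, hv⟩

theorem cone_mono {n : ℕ} {U W : Opens (CP n)} (h : U ≤ W) : cone U ⊆ cone W :=
  fun _ hz => ⟨hz.1, h hz.2⟩

/-- The sections over `U` of the line bundle `O(k)` on `ℂP^n`: the holomorphic functions on the
preimage of `U` in `ℂ^{n+1} \ {0}` which are homogeneous of degree `k`.  A function on the
preimage is stored as a function on `ℂ^{n+1}` which is zero elsewhere. -/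
def twist (n : ℕ) (k : ℤ) (U : Opens (CP n)) : Submodule ℂ (Coord n → ℂ) where
  carrier := {f | AnalyticOnNhd ℂ f (cone U) ∧
    (∀ z ∈ cone U, ∀ t : ℂ, t ≠ 0 → f (t • z) = t ^ k * f z) ∧ ∀ z ∉ cone U, f z = 0}
  zero_mem' := ⟨analyticOnNhd_const, by simp, by simp⟩
  add_mem' := by
    rintro f g ⟨hf1, hf2, hf3⟩ ⟨hg1, hg2, hg3⟩
    refine ⟨hf1.add hg1, fun z hz t ht => ?_, fun z hz => ?_⟩
    · simp only [Pi.add_apply, hf2 z hz t ht, hg2 z hz t ht]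
      ring
    · simp [hf3 z hz, hg3 z hz]
  smul_mem' := by
    rintro c f ⟨hf1, hf2, hf3⟩
    refine ⟨(analyticOnNhd_const (v := c)).smul hf1, fun z hz t ht => ?_, fun z hz => ?_⟩
    · simp only [Pi.smul_apply, hf2 z hz t ht, smul_eq_mul]
      ring
    · simp [hf3 z hz]

/-- Restriction of sections of `O(k)`. -/
def res {n : ℕ} {k : ℤ} {U W : Opens (CP n)} (h : U ≤ W) : twist n k W →ₗ[ℂ] twist n k U where
  toFun f := ⟨(cone U).indicator f.1, by
    obtain ⟨f, hf1, hf2, hf3⟩ := f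
    refine ⟨?_, ?_, fun z hz => Set.indicator_of_notMem hz f⟩
    · exact (hf1.mono (cone_mono h)).congr (isOpen_cone U)
        (fun z hz => (Set.indicator_of_mem hz f).symm)
    · intro z hz t ht
      have hz' : t • z ∈ cone U := by
        obtain ⟨h0, hU⟩ := hz
        refine ⟨smul_ne_zero ht h0, ?_⟩
        have : Projectivization.mk ℂ (t • z) (smul_ne_zero ht h0)
            = Projectivization.mk ℂ z h0 :=
          (Projectivization.mk_eq_mk_iff' ℂ _ _ _ _).2 ⟨t, rfl⟩
        rwa [this]
      simp only [Set.indicator_of_mem hz, Set.indicator_of_mem hz']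
      exact hf2 z (cone_mono h hz) t ht⟩
  map_add' f g := Subtype.ext (Set.indicator_add (cone U) f.1 g.1)
  map_smul' c f := Subtype.ext (Set.indicator_const_smul (cone U) c f.1)

/-- `H^0(ℂP^n, O(k))`, the global sections of `O(k)`. -/
abbrev H0 (n : ℕ) (k : ℤ) : Submodule ℂ (Coord n → ℂ) := twist n k ⊤

/-- The partial derivative `∂_{Z_i} f`. -/
def pd {n : ℕ} (i : Fin (n + 1)) (f : Coord n → ℂ) : Coord n → ℂ :=
  fun z => fderiv ℂ f z (Pi.single i 1)

/-- The iterated partial derivative `∂_{Z_{i_1}} ⋯ ∂_{Z_{i_r}} f` along a list of indices. -/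
def pds {n : ℕ} (l : List (Fin (n + 1))) (f : Coord n → ℂ) : Coord n → ℂ :=
  l.foldr pd f

/-- A matrix `Λ^{αβ}` of global sections of `O(2)`.  The biderivation `Λ^{αβ} ∂_α ⊗ ∂_β` then
has order zero: it maps `O(k) × O(l)` to `O(k + l)`, and in particular acts on `O = O(0)`. -/
abbrev Bivector (n : ℕ) : Type := Fin (n + 1) → Fin (n + 1) → H0 n 2

/-- The biderivation `{f, g} = Λ^{αβ} ∂_α f ∂_β g`. -/
def bracket {n : ℕ} (Λ : Bivector n) (f g : Coord n → ℂ) : Coord n → ℂ :=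
  fun z => ∑ a, ∑ b, (Λ a b).1 z * pd a f z * pd b g z

/-- Skew symmetry of the biderivation, on local sections of all the `O(k)`. -/
def IsSkew {n : ℕ} (Λ : Bivector n) : Prop :=
  ∀ (U : Opens (CP n)) (k l : ℤ) (f : twist n k U) (g : twist n l U), ∀ z ∈ cone U,
    bracket Λ f.1 g.1 z = -bracket Λ g.1 f.1 z

/-- The Jacobi rule for the biderivation, on local sections of all the `O(k)`. -/
def IsJacobi {n : ℕ} (Λ : Bivector n) : Prop :=
  ∀ (U : Opens (CP n)) (k l m : ℤ) (f : twist n k U) (g : twist n l U) (h : twist n m U),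
    ∀ z ∈ cone U,
      bracket Λ f.1 (bracket Λ g.1 h.1) z + bracket Λ g.1 (bracket Λ h.1 f.1) z +
        bracket Λ h.1 (bracket Λ f.1 g.1) z = 0

/-- `Λ^{α_1 β_1} ⋯ Λ^{α_r β_r} ∂_{α_1} ⋯ ∂_{α_r} f ∂_{β_1} ⋯ ∂_{β_r} g`, summed over all
indices. -/
def biPow {n : ℕ} (Λ : Bivector n) (r : ℕ) (f g : Coord n → ℂ) : Coord n → ℂ :=
  fun z => ∑ α : Fin r → Fin (n + 1), ∑ β : Fin r → Fin (n + 1),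
    (∏ i, (Λ (α i) (β i)).1 z) * pds (List.ofFn α) f z * pds (List.ofFn β) g z

/-- The place of `Λ^{α_i β_i}` in the string `f, Λ^{α_1 β_1}, …, Λ^{α_r β_r}, g`, whose places
are numbered `0, …, r + 1`. -/
def mid {r : ℕ} (i : Fin r) : Fin (r + 2) := i.succ.castSucc

/-- The expression
`f (←∂_{α_1} Λ^{α_1 β_1} →∂_{β_1}) ⋯ (←∂_{α_r} Λ^{α_r β_r} →∂_{β_r}) g`, summed over all indices,
where `←∂` differentiates the product of all functions to its left and `→∂` the product of all
functions to its right.  By the Leibniz rule this is the sum over all `s`, `t` where `s i` is the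
place, left of `Λ^{α_i β_i}`, of the factor that `←∂_{α_i}` differentiates, and `t i` is the place,
right of `Λ^{α_i β_i}`, of the factor that `→∂_{β_i}` differentiates. -/
def arrowPow {n : ℕ} (Λ : Bivector n) (r : ℕ) (f g : Coord n → ℂ) : Coord n → ℂ :=
  fun z => ∑ α : Fin r → Fin (n + 1), ∑ β : Fin r → Fin (n + 1),
    ∑ s ∈ Fintype.piFinset (fun i : Fin r => Finset.Iio (mid i)),
    ∑ t ∈ Fintype.piFinset (fun i : Fin r => Finset.Ioi (mid i)),
      ∏ p : Fin (r + 2),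
        pds (((List.finRange r).filter (fun i => s i = p)).map α ++
            ((List.finRange r).filter (fun i => t i = p)).map β)
          ((Fin.cons f (Fin.snoc (fun i => (Λ (α i) (β i)).1) g : Fin (r + 1) → Coord n → ℂ) :
            Fin (r + 2) → Coord n → ℂ) p) z

/-- The assumption that all `r`-fold products of the biderivation agree with the operators in
which the coefficients `Λ^{α_i β_i}` are not differentiated. -/
def HasArrowRelation {n : ℕ} (Λ : Bivector n) : Prop :=
  ∀ (r : ℕ) (U : Opens (CP n)) (k l : ℤ) (f : twist n k U) (g : twist n l U), ∀ z ∈ cone U,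
    arrowPow Λ r f.1 g.1 z = biPow Λ r f.1 g.1 z

/-- The coefficient of `μ^r` in `f # g`. -/
def sharpTerm {n : ℕ} (Λ : Bivector n) (r : ℕ) (f g : Coord n → ℂ) : Coord n → ℂ :=
  fun z => 1 / (r.factorial : ℂ) * (1 / 2) ^ r * biPow Λ r f g z

/-- The kinds of formal expressions in `μ`: Laurent polynomials `[μ, μ⁻¹]`, Laurent series in
`μ⁻¹` (finitely many positive powers of `μ`), Laurent series in `μ` (finitely many negative
powers of `μ`). -/
inductive FormalKind : Type
  | laurentPolynomial
  | seriesInMuInv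
  | seriesInMu

/-- The sets of exponents that may occur. -/
def FormalKind.Allows : FormalKind → Set ℤ → Prop
  | .laurentPolynomial, s => s.Finite
  | .seriesInMuInv, s => BddAbove s
  | .seriesInMu, s => BddBelow s

theorem FormalKind.Allows.mono {ν : FormalKind} {s t : Set ℤ} (ht : ν.Allows t) (h : s ⊆ t) :
    ν.Allows s := by
  cases ν
  · exact Set.Finite.subset ht h
  · exact BddAbove.mono h ht
  · exact BddBelow.mono h ht

theorem FormalKind.Allows.union {ν : FormalKind} {s t : Set ℤ} (hs : ν.Allows s)
    (ht : ν.Allows t) : ν.Allows (s ∪ t) := by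
  cases ν
  · exact Set.Finite.union hs ht
  · exact BddAbove.union hs ht
  · exact BddBelow.union hs ht

theorem FormalKind.allows_empty (ν : FormalKind) : ν.Allows ∅ := by
  cases ν
  · exact Set.finite_empty
  · exact bddAbove_empty
  · exact bddBelow_empty

/-- Formal expressions `∑_i a_i μ^i` of the given kind with coefficients in `M`. -/
def Formal (ν : FormalKind) (M : Type*) [AddCommGroup M] [Module ℂ M] : Submodule ℂ (ℤ → M) where
  carrier := {a | ν.Allows (Function.support a)}
  zero_mem' := by
    simpa [Function.support_zero] using ν.allows_empty
  add_mem' := fun {a b} ha hb => (ha.union hb).mono (Function.support_add a b)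
  smul_mem' := fun c a ha => FormalKind.Allows.mono ha (Function.support_const_smul_subset c a)

/-- `⊕_{k ≥ 0} H^0(ℂP^n, O(k))`. -/
abbrev Sections (n : ℕ) : Type := ⨁ k : ℕ, H0 n (k : ℤ)

/-- The inclusion of `H^0(ℂP^n, O(k))` in the direct sum. -/
abbrev ofDegree (n : ℕ) (k : ℕ) : H0 n (k : ℤ) →ₗ[ℂ] Sections n :=
  DirectSum.lof ℂ ℕ (fun k : ℕ => H0 n (k : ℤ)) k

/-- `⊕_{k ≥ 0} H^0(ℂP^n, O(k))[[♮]]`. -/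
abbrev FormalSections (n : ℕ) (ν : FormalKind) : Type := ⨁ k : ℕ, Formal ν (H0 n (k : ℤ))

/-- The inclusion of `H^0(ℂP^n, O(k))[[♮]]` in the direct sum. -/
abbrev ofFormalDegree (n : ℕ) (ν : FormalKind) (k : ℕ) :
    Formal ν (H0 n (k : ℤ)) →ₗ[ℂ] FormalSections n ν :=
  DirectSum.lof ℂ ℕ (fun k : ℕ => Formal ν (H0 n (k : ℤ))) k

/-- The bilinear product `star` on `⊕_{k ≥ 0} H^0(ℂP^n, O(k))[[♮]]` is the one induced by `#`:
for `a = ∑ a_i μ^i` of degree `k` and `b = ∑ b_j μ^j` of degree `l`, `star a b = ∑ c_m μ^m` has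
degree `k + l`, and over every open `U ⊆ ℂP^n` the section `c_m` is the sum of the finitely many
nonzero terms `sharpTerm Λ r a_i b_j` with `r + i + j = m`, computed from the restrictions of
`a_i` and `b_j` to `U`. -/
def IsSharp {n : ℕ} (Λ : Bivector n) (ν : FormalKind)
    (star : FormalSections n ν →ₗ[ℂ] FormalSections n ν →ₗ[ℂ] FormalSections n ν) : Prop :=
  ∀ (k l : ℕ) (a : Formal ν (H0 n (k : ℤ))) (b : Formal ν (H0 n (l : ℤ))),
    ∃ c : Formal ν (H0 n ((k + l : ℕ) : ℤ)),
      star (ofFormalDegree n ν k a) (ofFormalDegree n ν l b) = ofFormalDegree n ν (k + l) c ∧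
      ∀ (m : ℤ) (U : Opens (CP n)),
        {p : ℕ × ℤ | ∃ z ∈ cone U, sharpTerm Λ p.1 (res le_top (a.1 p.2) : twist n k U).1
          (res le_top (b.1 (m - p.1 - p.2)) : twist n l U).1 z ≠ 0}.Finite ∧
        ∀ z ∈ cone U, (c.1 m).1 z =
          ∑ᶠ p : ℕ × ℤ, sharpTerm Λ p.1 (res le_top (a.1 p.2) : twist n k U).1
            (res le_top (b.1 (m - p.1 - p.2)) : twist n l U).1 z

/-- The bilinear product `star` on `⊕_{k ≥ 0} H^0(ℂP^n, O(k))` is the one induced by `#` with `μ`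
replaced by the scalar `c`, the sum over `r` being finite. -/
def IsSharpAt {n : ℕ} (Λ : Bivector n) (c : ℂ)
    (star : Sections n →ₗ[ℂ] Sections n →ₗ[ℂ] Sections n) : Prop :=
  ∀ (k l : ℕ) (f : H0 n (k : ℤ)) (g : H0 n (l : ℤ)),
    ∃ h : H0 n ((k + l : ℕ) : ℤ),
      star (ofDegree n k f) (ofDegree n l g) = ofDegree n (k + l) h ∧
      ∀ U : Opens (CP n),
        {r : ℕ | ∃ z ∈ cone U, sharpTerm Λ r (res le_top f : twist n k U).1
          (res le_top g : twist n l U).1 z ≠ 0}.Finite ∧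
        ∀ z ∈ cone U, h.1 z =
          ∑ᶠ r : ℕ, c ^ r * sharpTerm Λ r (res le_top f : twist n k U).1
            (res le_top g : twist n l U).1 z

/-- Substituting `c` for `μ` in a Laurent polynomial. -/
def evalMu (c : ℂ) (M : Type*) [AddCommGroup M] [Module ℂ M] :
    Formal .laurentPolynomial M →ₗ[ℂ] M where
  toFun a := ∑ᶠ i : ℤ, c ^ i • a.1 i
  map_add' a b := by
    have ha : (Function.support fun i : ℤ => c ^ i • a.1 i).Finite :=
      Set.Finite.subset a.2 (Function.support_smul_subset_right _ _)
    have hb : (Function.support fun i : ℤ => c ^ i • b.1 i).Finite :=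
      Set.Finite.subset b.2 (Function.support_smul_subset_right _ _)
    rw [← finsum_add_distrib ha hb]
    simp [smul_add]
  map_smul' d a := by
    simp only [RingHom.id_apply, smul_finsum]
    refine finsum_congr fun i => ?_
    simp [smul_comm d]

/-- Substituting `c` for `μ` in `⊕_{k ≥ 0} H^0(ℂP^n, O(k))[μ, μ⁻¹]`. -/
def evalSections (n : ℕ) (c : ℂ) : FormalSections n .laurentPolynomial →ₗ[ℂ] Sections n :=
  DirectSum.toModule ℂ ℕ (Sections n) fun k => ofDegree n k ∘ₗ evalMu c (H0 n (k : ℤ))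

end SymbolCalculus

end

/-! The hypotheses enter through one consequence: the coefficients are constant along the
Hamiltonian fields of the coordinates, `∑ e, Λ^{ae} ∂_e Λ^{bc} = 0` (`coeffDer_eq_zero`). Write
`T^{abc}` for this sum. The arrow relation for `r = 2`, tested on `f = z_a` and on `g = z_b` and `g
= z_b z_c`, shows that `T` changes sign when its outer indices are exchanged; skewness gives the
same for the last two. So `T` is totally antisymmetric, its cyclic sum is `3T`, and the Jacobi rule
makes it zero.

The product then behaves like a Moyal product with constant coefficients. Let `P₁₂`, `P₁₃`, `P₂₃` be
the biderivation acting on two of three arguments; they commute. Because the coefficients pass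
through all products, iterated products become `(P₁₃ + P₂₃)^s P₁₂^r` and `(P₁₂ + P₁₃)^s P₂₃^r`
applied to `fgh` (`biOp_biOp_left`, `biOp_biOp_right`). By the binomial theorem the coefficient of
`μ^m` is `(P₁₂ + P₁₃ + P₂₃)^m / (2^m m!)` for both bracketings (`starOp_assoc`).

Finiteness is a degree count: a partial derivative lowers the degree by one and kills degree zero
(`partialDer_eq_zero`), so the `r`-th term vanishes once `r` exceeds the degree of the left factor
(`biOp_left_eq_zero`). All sums are therefore finite for each kind of formal expression and can be
reindexed (`conv_assoc`, `evalMu_formalMul`). Non-commutativity is visible on coordinates: `z_a #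
z_b - z_b # z_a = μ Λ^{ab}`. -/

noncomputable section

namespace SymbolCalculus

/-! ### Star products from commuting derivations of a commutative algebra. -/

section Algebra

variable {R ι : Type*} [CommRing R] [Algebra ℂ R] [Fintype ι]

/-- The `r`-th power of the biderivation `∑ L a b D_a ⊗ D_b`, with undifferentiated
coefficients. -/
def biOp (D : ι → Derivation ℂ R R) (L : ι → ι → R) : ℕ → R →ₗ[ℂ] R →ₗ[ℂ] R
  | 0 => LinearMap.mul ℂ R
  | r + 1 => ∑ a, ∑ b, L a b • (biOp D L r).compl₁₂ (D a).toLinearMap (D b).toLinearMap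

variable {D : ι → Derivation ℂ R R} {L : ι → ι → R}

@[simp] theorem biOp_zero (f g : R) : biOp D L 0 f g = f * g := rfl

theorem biOp_succ (r : ℕ) (f g : R) :
    biOp D L (r + 1) f g = ∑ a, ∑ b, L a b * biOp D L r (D a f) (D b g) := by
  simp [biOp, LinearMap.sum_apply]

/-- The coefficients may be pulled out of the left argument, because they are constant along
all the vector fields `∑ L a b D_a`. -/
theorem biOp_coeff_mul_left (hL : ∀ b d e, ∑ a, L a b * D a (L d e) = 0) (r : ℕ) (d e : ι)
    (f g : R) : biOp D L r (L d e * f) g = L d e * biOp D L r f g := by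
  induction r generalizing d e f g with
  | zero => simp [mul_assoc]
  | succ r ih =>
    -- The induction hypothesis, read backwards, carries `L a b` into the left slot, where it meets
    -- `D a (L d e)` and `hL` applies.
    have h0 : ∑ a, ∑ b, L a b * biOp D L r (D a (L d e) * f) (D b g) = 0 := by
      simp_rw [← ih]
      rw [Finset.sum_comm]
      refine Finset.sum_eq_zero fun b _ => ?_
      rw [← LinearMap.sum_apply, ← map_sum]
      simp_rw [← mul_assoc]
      rw [← Finset.sum_mul, hL]
      simp
    rw [biOp_succ, biOp_succ]
    simp only [Derivation.leibniz, smul_eq_mul, map_add, LinearMap.add_apply, mul_add,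
      Finset.sum_add_distrib, ih]
    rw [Finset.mul_sum]
    simp_rw [mul_comm f, h0, add_zero, Finset.mul_sum]
    exact Finset.sum_congr rfl fun a _ => Finset.sum_congr rfl fun b _ => by ring

theorem biOp_coeff_mul_right (hL : ∀ a d e, ∑ b, L a b * D b (L d e) = 0) (r : ℕ) (d e : ι)
    (f g : R) : biOp D L r f (L d e * g) = L d e * biOp D L r f g := by
  induction r generalizing d e f g with
  | zero => simp [mul_left_comm]
  | succ r ih =>
    have h0 : ∑ a, ∑ b, L a b * biOp D L r (D a f) (D b (L d e) * g) = 0 := by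
      simp_rw [← ih]
      refine Finset.sum_eq_zero fun b _ => ?_
      rw [← map_sum]
      simp_rw [← mul_assoc]
      rw [← Finset.sum_mul, hL]
      simp
    rw [biOp_succ, biOp_succ]
    simp only [Derivation.leibniz, smul_eq_mul, map_add, mul_add,
      Finset.sum_add_distrib, ih]
    rw [Finset.mul_sum]
    simp_rw [mul_comm g, h0, add_zero, Finset.mul_sum]
    exact Finset.sum_congr rfl fun a _ => Finset.sum_congr rfl fun b _ => by ring

/-- Leibniz rule for a vector field that annihilates the coefficients. -/
theorem biOp_leibniz {c : ι → R} (hD : ∀ a b f, D a (D b f) = D b (D a f))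
    (hc : ∀ d e, ∑ a, c a * D a (L d e) = 0) (r : ℕ) (f g : R) :
    ∑ a, c a * D a (biOp D L r f g) =
      ∑ a, c a * (biOp D L r (D a f) g + biOp D L r f (D a g)) := by
  induction r generalizing f g with
  | zero =>
    refine Finset.sum_congr rfl fun a _ => ?_
    simp only [biOp_zero, Derivation.leibniz, smul_eq_mul]
    ring
  | succ r ih =>
    have h1 : ∀ a, c a * D a (biOp D L (r + 1) f g) =
        ∑ d, ∑ e, (L d e * (c a * D a (biOp D L r (D d f) (D e g))) +
          biOp D L r (D d f) (D e g) * (c a * D a (L d e))) := by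
      intro a
      simp only [biOp_succ, map_sum, Derivation.leibniz, smul_eq_mul, Finset.mul_sum]
      exact Finset.sum_congr rfl fun d _ => Finset.sum_congr rfl fun e _ => by ring
    simp_rw [h1]
    rw [Finset.sum_comm]
    have h2 : ∀ d, ∑ a, ∑ e, (L d e * (c a * D a (biOp D L r (D d f) (D e g))) +
          biOp D L r (D d f) (D e g) * (c a * D a (L d e))) =
        ∑ a, ∑ e, L d e * (c a * (biOp D L r (D d (D a f)) (D e g) +
          biOp D L r (D d f) (D e (D a g)))) := by
      intro d
      rw [Finset.sum_comm]
      conv_rhs => rw [Finset.sum_comm]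
      refine Finset.sum_congr rfl fun e _ => ?_
      -- `hc` removes the terms in which the vector field hits the coefficient `L d e`.
      rw [Finset.sum_add_distrib, ← Finset.mul_sum, ← Finset.mul_sum, hc, mul_zero, add_zero, ih,
        Finset.mul_sum]
      simp_rw [hD _ d, hD _ e]
    simp_rw [h2]
    rw [Finset.sum_comm]
    refine Finset.sum_congr rfl fun a _ => ?_
    simp_rw [biOp_succ, mul_add, Finset.mul_sum, ← Finset.sum_add_distrib]
    exact Finset.sum_congr rfl fun d _ => Finset.sum_congr rfl fun e _ => by ring

/-- The biderivation acting on the first two of three arguments. -/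
def triOp₁₂ (D : ι → Derivation ℂ R R) (L : ι → ι → R) : Module.End ℂ (R → R → R → R) where
  toFun F f g h := ∑ a, ∑ b, L a b * F (D a f) (D b g) h
  map_add' F G := by
    ext f g h; simp only [Pi.add_apply, mul_add, Finset.sum_add_distrib]
  map_smul' c F := by
    ext f g h; simp only [Pi.smul_apply, mul_smul_comm, Finset.smul_sum, RingHom.id_apply]

/-- The biderivation acting on the first and the third of three arguments. -/
def triOp₁₃ (D : ι → Derivation ℂ R R) (L : ι → ι → R) : Module.End ℂ (R → R → R → R) where
  toFun F f g h := ∑ a, ∑ b, L a b * F (D a f) g (D b h)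
  map_add' F G := by
    ext f g h; simp only [Pi.add_apply, mul_add, Finset.sum_add_distrib]
  map_smul' c F := by
    ext f g h; simp only [Pi.smul_apply, mul_smul_comm, Finset.smul_sum, RingHom.id_apply]

/-- The biderivation acting on the last two of three arguments. -/
def triOp₂₃ (D : ι → Derivation ℂ R R) (L : ι → ι → R) : Module.End ℂ (R → R → R → R) where
  toFun F f g h := ∑ a, ∑ b, L a b * F f (D a g) (D b h)
  map_add' F G := by
    ext f g h; simp only [Pi.add_apply, mul_add, Finset.sum_add_distrib]
  map_smul' c F := by
    ext f g h; simp only [Pi.smul_apply, mul_smul_comm, Finset.smul_sum, RingHom.id_apply]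

theorem sum₄_comm {M : Type*} [AddCommMonoid M] (F : ι → ι → ι → ι → M) :
    ∑ a, ∑ b, ∑ c, ∑ d, F a b c d = ∑ c, ∑ d, ∑ a, ∑ b, F a b c d := by
  have := Finset.sum_comm (s := (Finset.univ : Finset (ι × ι)))
    (t := (Finset.univ : Finset (ι × ι))) (f := fun p q => F p.1 p.2 q.1 q.2)
  simpa only [Fintype.sum_prod_type] using this

/-- The coefficients stay outside `F` and are never differentiated, so commuting derivations
suffice; no condition on `L` is needed. -/
theorem triOp_commute₁₂₁₃ (hD : ∀ a b f, D a (D b f) = D b (D a f)) :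
    Commute (triOp₁₂ D L) (triOp₁₃ D L) := by
  ext F f g h
  simp only [Module.End.mul_apply, triOp₁₂, triOp₁₃, LinearMap.coe_mk, AddHom.coe_mk,
    Finset.mul_sum]
  rw [sum₄_comm]
  exact Finset.sum_congr rfl fun a _ => Finset.sum_congr rfl fun b _ =>
    Finset.sum_congr rfl fun c _ => Finset.sum_congr rfl fun d _ => by rw [hD a c]; ring

theorem triOp_commute₁₂₂₃ (hD : ∀ a b f, D a (D b f) = D b (D a f)) :
    Commute (triOp₁₂ D L) (triOp₂₃ D L) := by
  ext F f g h
  simp only [Module.End.mul_apply, triOp₁₂, triOp₂₃, LinearMap.coe_mk, AddHom.coe_mk,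
    Finset.mul_sum]
  rw [sum₄_comm]
  exact Finset.sum_congr rfl fun a _ => Finset.sum_congr rfl fun b _ =>
    Finset.sum_congr rfl fun c _ => Finset.sum_congr rfl fun d _ => by rw [hD a d]; ring

theorem triOp_commute₁₃₂₃ (hD : ∀ a b f, D a (D b f) = D b (D a f)) :
    Commute (triOp₁₃ D L) (triOp₂₃ D L) := by
  ext F f g h
  simp only [Module.End.mul_apply, triOp₁₃, triOp₂₃, LinearMap.coe_mk, AddHom.coe_mk,
    Finset.mul_sum]
  rw [sum₄_comm]
  exact Finset.sum_congr rfl fun a _ => Finset.sum_congr rfl fun b _ =>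
    Finset.sum_congr rfl fun c _ => Finset.sum_congr rfl fun d _ => by rw [hD b d]; ring

/-- A Hamiltonian field acting on `biOp D L r f g` acts on `f` or on `g` by `biOp_leibniz`, so each
outer biderivation contributes one factor `P₁₃ + P₂₃`. -/
theorem biOp_biOp_left (hD : ∀ a b f, D a (D b f) = D b (D a f))
    (hL : ∀ b d e, ∑ a, L a b * D a (L d e) = 0) (s r : ℕ) :
    (fun f g h => biOp D L s (biOp D L r f g) h) =
      ((triOp₁₃ D L + triOp₂₃ D L) ^ s * triOp₁₂ D L ^ r) fun f g h => f * g * h := by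
  induction s with
  | zero =>
    simp only [biOp_zero, pow_zero, one_mul]
    induction r with
    | zero => rfl
    | succ r ih =>
      rw [pow_succ', Module.End.mul_apply, ← ih]
      ext f g h
      simp [triOp₁₂, biOp_succ, Finset.sum_mul, mul_assoc]
  | succ s ih =>
    rw [pow_succ', mul_assoc, Module.End.mul_apply, ← ih]
    ext f g h
    simp only [LinearMap.add_apply, triOp₁₃, triOp₂₃, LinearMap.coe_mk, AddHom.coe_mk,
      Pi.add_apply]
    have e : ∀ a b v w, biOp D L s (L a b * v) w = L a b * biOp D L s v w :=
      biOp_coeff_mul_left hL s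
    -- `L a b` is moved into the left slot to form a whole vector field acting on the inner product;
    -- after the Leibniz rule it is moved out again.
    trans ∑ b, biOp D L s (∑ a, L a b * D a (biOp D L r f g)) (D b h)
    · rw [biOp_succ, Finset.sum_comm]
      simp only [map_sum, LinearMap.sum_apply, e]
    · simp_rw [biOp_leibniz hD (hL _)]
      simp only [mul_add, map_sum, map_add, LinearMap.add_apply, LinearMap.sum_apply, e,
        Finset.sum_add_distrib]
      congr 1 <;> exact Finset.sum_comm

theorem biOp_biOp_right (hD : ∀ a b f, D a (D b f) = D b (D a f))
    (hL : ∀ a d e, ∑ b, L a b * D b (L d e) = 0) (s r : ℕ) :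
    (fun f g h => biOp D L s f (biOp D L r g h)) =
      ((triOp₁₂ D L + triOp₁₃ D L) ^ s * triOp₂₃ D L ^ r) fun f g h => f * g * h := by
  induction s with
  | zero =>
    simp only [biOp_zero, pow_zero, one_mul]
    induction r with
    | zero => ext; simp [mul_assoc]
    | succ r ih =>
      rw [pow_succ', Module.End.mul_apply, ← ih]
      ext f g h
      simp [triOp₂₃, biOp_succ, Finset.mul_sum, mul_left_comm]
  | succ s ih =>
    rw [pow_succ', mul_assoc, Module.End.mul_apply, ← ih]
    ext f g h
    simp only [LinearMap.add_apply, triOp₁₃, triOp₁₂, LinearMap.coe_mk, AddHom.coe_mk,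
      Pi.add_apply]
    have e : ∀ a b v w, biOp D L s v (L a b * w) = L a b * biOp D L s v w :=
      biOp_coeff_mul_right hL s
    trans ∑ a, biOp D L s (D a f) (∑ b, L a b * D b (biOp D L r g h))
    · rw [biOp_succ]
      simp only [map_sum, e]
    · simp_rw [biOp_leibniz hD (hL _)]
      simp only [mul_add, map_sum, map_add, e, Finset.sum_add_distrib]

/-- The coefficient of `μ ^ r` in the star product. -/
def starOp (D : ι → Derivation ℂ R R) (L : ι → ι → R) (r : ℕ) : R →ₗ[ℂ] R →ₗ[ℂ] R :=
  (1 / (r.factorial : ℂ) * (1 / 2) ^ r) • biOp D L r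

/-- The degree `m` part of `exp (y/2) exp (x/2) = exp ((x + y)/2)`. -/
theorem sum_antidiagonal_pow {A : Type*} [Ring A] [Algebra ℂ A] {x y : A} (h : Commute x y)
    (m : ℕ) :
    ∑ p ∈ Finset.HasAntidiagonal.antidiagonal m, ((1 / (p.2.factorial : ℂ) * (1 / 2) ^ p.2) *
      (1 / (p.1.factorial : ℂ) * (1 / 2) ^ p.1)) • (y ^ p.2 * x ^ p.1) =
      (1 / (m.factorial : ℂ) * (1 / 2) ^ m) • (x + y) ^ m := by
  rw [h.add_pow', Finset.smul_sum]
  refine Finset.sum_congr rfl fun p hp => ?_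
  obtain rfl := Finset.HasAntidiagonal.mem_antidiagonal.1 hp
  rw [← Nat.cast_smul_eq_nsmul ℂ, smul_smul, (h.pow_pow p.1 p.2).eq]
  congr 1
  have h1 := Nat.factorial_ne_zero p.1
  have h2 := Nat.factorial_ne_zero p.2
  have h3 := Nat.factorial_ne_zero (p.1 + p.2)
  have h4 : (((p.1 + p.2).choose p.1 : ℕ) : ℂ) * p.1.factorial * p.2.factorial =
      (p.1 + p.2).factorial := by
    rw [Nat.choose_symm_add]
    exact_mod_cast Nat.add_choose_mul_factorial_mul_factorial p.1 p.2
  rw [pow_add]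
  field_simp
  linear_combination -h4

/-- Associativity of the star product, degree by degree in `μ`. -/
theorem starOp_assoc (hD : ∀ a b f, D a (D b f) = D b (D a f))
    (hL : ∀ b d e, ∑ a, L a b * D a (L d e) = 0) (hL' : ∀ a d e, ∑ b, L a b * D b (L d e) = 0)
    (m : ℕ) (f g h : R) :
    ∑ p ∈ Finset.HasAntidiagonal.antidiagonal m, starOp D L p.2 (starOp D L p.1 f g) h =
      ∑ p ∈ Finset.HasAntidiagonal.antidiagonal m, starOp D L p.2 f (starOp D L p.1 g h) := by
  have c12 := triOp_commute₁₂₁₃ (L := L) hD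
  have c23 := triOp_commute₁₂₂₃ (L := L) hD
  have c13 := triOp_commute₁₃₂₃ (L := L) hD
  have h1 := congrArg (fun T => T (fun f g h => f * g * h) f g h)
    (sum_antidiagonal_pow (c12.add_right c23) m)
  have h2 := congrArg (fun T => T (fun f g h => f * g * h) f g h)
    (sum_antidiagonal_pow (c23.symm.add_right c13.symm) m)
  have h3 : triOp₁₂ D L + (triOp₁₃ D L + triOp₂₃ D L) =
    triOp₂₃ D L + (triOp₁₂ D L + triOp₁₃ D L) := by abel
  rw [h3] at h1
  have h4 := h1.trans h2.symm
  simp only [LinearMap.sum_apply, LinearMap.smul_apply, Finset.sum_apply, Pi.smul_apply,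
    ← biOp_biOp_left hD hL, ← biOp_biOp_right hD hL'] at h4
  simpa [starOp, smul_smul, mul_comm, mul_left_comm] using h4

end Algebra

/-! ### Holomorphic functions on the punctured space and their partial derivatives. -/

variable {n : ℕ}

theorem cone_top : cone (⊤ : Opens (CP n)) = {0}ᶜ := by
  ext z; simp [cone]

theorem isOpen_punctured : IsOpen ({0}ᶜ : Set (Coord n)) := isOpen_compl_singleton

theorem analyticOnNhd_pd {s : Set (Coord n)} {f : Coord n → ℂ} (hf : AnalyticOnNhd ℂ f s)
    (i : Fin (n + 1)) : AnalyticOnNhd ℂ (pd i f) s := fun z hz =>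
  ((ContinuousLinearMap.apply ℂ ℂ (Pi.single i (1 : ℂ) : Coord n)).analyticAt _).comp
    (hf z hz).fderiv

theorem pd_congr {s : Set (Coord n)} (hs : IsOpen s) {f g : Coord n → ℂ} (h : Set.EqOn f g s)
    (i : Fin (n + 1)) : Set.EqOn (pd i f) (pd i g) s := fun z hz => by
  have : f =ᶠ[nhds z] g := h.eventuallyEq_of_mem (hs.mem_nhds hz)
  simp only [pd, this.fderiv_eq]

theorem pds_congr {s : Set (Coord n)} (hs : IsOpen s) {f g : Coord n → ℂ} (h : Set.EqOn f g s)
    (l : List (Fin (n + 1))) : Set.EqOn (pds l f) (pds l g) s := by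
  induction l with
  | nil => exact h
  | cons i l ih => exact pd_congr hs ih i

theorem pd_comm {f : Coord n → ℂ} {z : Coord n} (hf : AnalyticAt ℂ f z) (i j : Fin (n + 1)) :
    pd i (pd j f) z = pd j (pd i f) z := by
  have hd : DifferentiableAt ℂ (fderiv ℂ f) z := hf.fderiv.differentiableAt
  have h : ∀ i j, pd i (pd j f) z = fderiv ℂ (fderiv ℂ f) z (Pi.single i 1) (Pi.single j 1) := by
    intro i j
    unfold pd
    rw [fderiv_clm_apply hd (differentiableAt_const _)]
    simp
  rw [h, h]
  exact (hf.contDiffAt (n := 2)).isSymmSndFDerivAt (by simp) _ _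

theorem pd_mul {f g : Coord n → ℂ} {z : Coord n} (hf : DifferentiableAt ℂ f z)
    (hg : DifferentiableAt ℂ g z) (i : Fin (n + 1)) :
    pd i (f * g) z = f z * pd i g z + g z * pd i f z := by
  simp [pd, fderiv_mul hf hg]

/-- The functions that are holomorphic on `ℂ^{n+1} \ {0}`. -/
def puncturedHolo (n : ℕ) : Subalgebra ℂ (Coord n → ℂ) where
  carrier := {f | AnalyticOnNhd ℂ f {0}ᶜ}
  mul_mem' hf hg := hf.mul hg
  add_mem' hf hg := hf.add hg
  algebraMap_mem' _ := analyticOnNhd_const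

instance : CommRing (puncturedHolo n) := (puncturedHolo n).toCommRing

instance : CommSemiring (puncturedHolo n) := CommRing.toCommSemiring

instance : Semiring (puncturedHolo n) := CommSemiring.toSemiring

instance : AddCommMonoid (puncturedHolo n) := NonUnitalNonAssocSemiring.toAddCommMonoid

instance : Algebra ℂ (puncturedHolo n) := (puncturedHolo n).algebra

instance : Module ℂ (puncturedHolo n) := Algebra.toModule

instance : Module (puncturedHolo n) (puncturedHolo n) := Semiring.toModule

theorem differentiableAt_holo (f : puncturedHolo n) {z : Coord n} (hz : z ≠ 0) :
    DifferentiableAt ℂ f.1 z := (f.2 z hz).differentiableAt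

/-- The partial derivative as a derivation of the holomorphic functions on `ℂ^{n+1} \ {0}`. -/
def partialDer (i : Fin (n + 1)) : Derivation ℂ (puncturedHolo n) (puncturedHolo n) :=
  Derivation.mk'
    -- Elements of `puncturedHolo` are unconstrained at the origin. Giving the derivative the value
    -- zero there makes the derivation rules hold as equalities of functions on the whole space.
    { toFun f := ⟨({0}ᶜ : Set (Coord n)).indicator (pd i f.1),
        (analyticOnNhd_pd f.2 i).congr isOpen_punctured
          fun _ hz => (Set.indicator_of_mem hz _).symm⟩
      map_add' f g := by
        ext z
        by_cases hz : z = 0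
        · simp [hz]
        · simp [hz, pd, fderiv_add (differentiableAt_holo f hz) (differentiableAt_holo g hz)]
      map_smul' c f := by
        ext z
        by_cases hz : z = 0
        · simp [hz]
        · simp [hz, pd, fderiv_const_smul (differentiableAt_holo f hz)] } (by
    intro f g
    ext z
    by_cases hz : z = 0
    · simp [hz]
    · simpa [hz] using pd_mul (differentiableAt_holo f hz) (differentiableAt_holo g hz) i)

theorem partialDer_apply (i : Fin (n + 1)) (f : puncturedHolo n) :
    (partialDer i f).1 = ({0}ᶜ : Set (Coord n)).indicator (pd i f.1) := rfl

theorem partialDer_eqOn (i : Fin (n + 1)) (f : puncturedHolo n) :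
    Set.EqOn (partialDer i f).1 (pd i f.1) {0}ᶜ := fun _ hz => Set.indicator_of_mem hz _

theorem partialDer_comm (i j : Fin (n + 1)) (f : puncturedHolo n) :
    partialDer i (partialDer j f) = partialDer j (partialDer i f) := by
  ext z
  by_cases hz : z = 0
  · simp [partialDer_apply, hz]
  · rw [partialDer_eqOn i _ hz, partialDer_eqOn j _ hz,
      pd_congr isOpen_punctured (partialDer_eqOn j f) i hz,
      pd_congr isOpen_punctured (partialDer_eqOn i f) j hz, pd_comm (f.2 z hz)]

/-! ### Homogeneous functions and vanishing by degree. -/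

/-- Homogeneity of degree `k` on `ℂ^{n+1} \ {0}`. -/
def IsHomog (k : ℤ) (f : puncturedHolo n) : Prop :=
  ∀ z : Coord n, z ≠ 0 → ∀ t : ℂ, t ≠ 0 → f.1 (t • z) = t ^ k * f.1 z

theorem IsHomog.mul {k l : ℤ} {f g : puncturedHolo n} (hf : IsHomog k f) (hg : IsHomog l g) :
    IsHomog (k + l) (f * g) := fun z hz t ht => by
  simp only [MulMemClass.coe_mul, Pi.mul_apply, hf z hz t ht, hg z hz t ht, zpow_add₀ ht]
  ring

theorem IsHomog.add {k : ℤ} {f g : puncturedHolo n} (hf : IsHomog k f) (hg : IsHomog k g) :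
    IsHomog k (f + g) := fun z hz t ht => by
  simp only [AddMemClass.coe_add, Pi.add_apply, hf z hz t ht, hg z hz t ht, mul_add]

theorem IsHomog.zero {k : ℤ} : IsHomog k (0 : puncturedHolo n) := fun z hz t ht => by simp

theorem IsHomog.smul {k : ℤ} {f : puncturedHolo n} (hf : IsHomog k f) (c : ℂ) :
    IsHomog k (c • f) := fun z hz t ht => by
  simp only [SetLike.val_smul, Pi.smul_apply, hf z hz t ht, smul_eq_mul]
  ring

theorem IsHomog.sum {k : ℤ} {ι : Type*} {s : Finset ι} {f : ι → puncturedHolo n}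
    (hf : ∀ i ∈ s, IsHomog k (f i)) : IsHomog k (∑ i ∈ s, f i) :=
  Finset.sum_induction f (IsHomog k) (fun _ _ h h' => h.add h') IsHomog.zero hf

theorem isHomog_partialDer {k : ℤ} {f : puncturedHolo n} (hf : IsHomog k f) (i : Fin (n + 1)) :
    IsHomog (k - 1) (partialDer i f) := fun z hz t ht => by
  have htz : t • z ≠ 0 := smul_ne_zero ht hz
  rw [partialDer_eqOn i f hz, partialDer_eqOn i f htz]
  have h1 : (fun w => f.1 (t • w)) =ᶠ[nhds z] fun w => t ^ k * f.1 w :=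
    Filter.eventuallyEq_of_mem (isOpen_punctured.mem_nhds hz) fun w hw => hf w hw t ht
  have h2 := h1.fderiv_eq (𝕜 := ℂ)
  rw [fderiv_const_mul (differentiableAt_holo f hz)] at h2
  have h3 : fderiv ℂ (fun w => f.1 (t • w)) z = t • fderiv ℂ f.1 (t • z) := fderiv_comp_smul ..
  rw [h3] at h2
  have h4 := congrArg (fun T => T (Pi.single i 1)) h2
  simp only [smul_apply, smul_eq_mul] at h4
  rw [zpow_sub_one₀ ht]
  simp only [pd]
  field_simp
  linear_combination h4

/-- There are no nonzero homogeneous functions of negative degree, if the dimension is at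
least two. -/
theorem IsHomog.eq_zero_of_neg {k : ℤ} {f : puncturedHolo n} (hf : IsHomog k f) (hn : n ≠ 0)
    (hk : k < 0) {z : Coord n} (hz : z ≠ 0) : f.1 z = 0 := by
  -- The line `z + t w` misses the origin, so `f` is entire on it. There it equals `t^k f(z/t + w)`,
  -- which tends to `0 · f(w)` as `t → ∞`, and Liouville's theorem applies.
  obtain ⟨w, hw⟩ : ∃ w : Coord n, LinearIndependent ℂ ![z, w] := by
    apply exists_linearIndependent_pair_of_one_lt_finrank _ hz
    simp; omega
  have hne : ∀ t : ℂ, z + t • w ≠ 0 := fun t h => by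
    have := LinearIndependent.pair_iff.1 hw 1 t (by simpa using h)
    simp at this
  have hw0 : w ≠ 0 := by simpa using hw.ne_zero 1
  have hd : Differentiable ℂ fun t : ℂ => f.1 (z + t • w) := fun t =>
    DifferentiableAt.comp t (differentiableAt_holo f (hne t)) (by fun_prop)
  have hlim : Filter.Tendsto (fun t : ℂ => f.1 (z + t • w)) (Filter.cocompact ℂ) (nhds 0) := by
    have h1 : (fun t : ℂ => t ^ k * f.1 (t⁻¹ • z + w)) =ᶠ[Filter.cocompact ℂ]
        fun t : ℂ => f.1 (z + t • w) := by
      have : {(0 : ℂ)}ᶜ ∈ Filter.cocompact ℂ := (isCompact_singleton).compl_mem_cocompact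
      filter_upwards [this] with t ht
      have ht' : t ≠ 0 := ht
      rw [← hf _ _ t ht', smul_add, smul_inv_smul₀ ht']
      intro h
      apply hne t
      rw [← smul_inv_smul₀ ht' z, ← smul_add, h, smul_zero]
    refine Filter.Tendsto.congr' h1 ?_
    have hinv : Filter.Tendsto (fun t : ℂ => t⁻¹) (Filter.cocompact ℂ) (nhds 0) :=
      Filter.tendsto_inv₀_cobounded.mono_left (by rw [Metric.cobounded_eq_cocompact])
    obtain ⟨m, rfl⟩ : ∃ m : ℕ, k = -((m + 1 : ℕ) : ℤ) := ⟨(-k - 1).toNat, by omega⟩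
    have hp : Filter.Tendsto (fun t : ℂ => t ^ (-((m + 1 : ℕ) : ℤ))) (Filter.cocompact ℂ)
        (nhds 0) := by
      refine Filter.Tendsto.congr (fun t => ?_) (by simpa using hinv.pow (m + 1))
      rw [zpow_neg, zpow_natCast]
    have hc : Filter.Tendsto (fun t : ℂ => f.1 (t⁻¹ • z + w)) (Filter.cocompact ℂ)
        (nhds (f.1 w)) := by
      have : Filter.Tendsto (fun t : ℂ => t⁻¹ • z + w) (Filter.cocompact ℂ) (nhds w) := by
        simpa using (hinv.smul_const z).add_const w
      exact (differentiableAt_holo f hw0).continuousAt.tendsto.comp this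
    simpa using hp.mul hc
  simpa using hd.apply_eq_of_tendsto_cocompact 0 hlim

/-- For `n ≠ 0` the derivative has degree `-1` and vanishes. For `n = 0` nonzero functions of degree
`-1` exist, but the punctured line is a single orbit of scaling, so `f` is already constant. -/
theorem partialDer_eq_zero {f : puncturedHolo n} (hf : IsHomog 0 f) (i : Fin (n + 1)) :
    partialDer i f = 0 := by
  ext z
  by_cases hz : z = 0
  · simp [partialDer_apply, hz]
  by_cases hn : n = 0
  · subst hn
    have h : Set.EqOn f.1 (fun _ => f.1 1) {0}ᶜ := fun w hw => by
      have hw0 : w 0 ≠ 0 := fun h => hw (by ext j; rw [Fin.fin_one_eq_zero j, h]; rfl)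
      have h1 : w = w 0 • (1 : Coord 0) := by
        ext j; rw [Fin.fin_one_eq_zero j]; simp
      rw [h1, hf _ one_ne_zero _ hw0]
      simp
    rw [partialDer_eqOn i f hz, pd_congr isOpen_punctured h i hz]
    simp [pd]
  · exact (isHomog_partialDer hf i).eq_zero_of_neg hn (by norm_num) hz

section

variable {L : Fin (n + 1) → Fin (n + 1) → puncturedHolo n}

theorem isHomog_biOp (hL : ∀ a b, IsHomog 2 (L a b)) (r : ℕ) {k l : ℤ} {f g : puncturedHolo n}
    (hf : IsHomog k f) (hg : IsHomog l g) :
    IsHomog (k + l) (biOp partialDer L r f g) := by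
  induction r generalizing k l f g with
  | zero => exact hf.mul hg
  | succ r ih =>
    rw [biOp_succ]
    refine IsHomog.sum fun a _ => IsHomog.sum fun b _ => ?_
    have := (hL a b).mul (ih (isHomog_partialDer hf a) (isHomog_partialDer hg b))
    convert this using 1
    ring

/-- The left degree drops by one at each step and the process ends at degree zero, so negative
degrees never occur in the induction and `n = 0` is covered. -/
theorem biOp_left_eq_zero {k : ℕ} {f : puncturedHolo n} (hf : IsHomog k f) {r : ℕ}
    (hr : k < r) (g : puncturedHolo n) : biOp partialDer L r f g = 0 := by
  induction k generalizing r f g with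
  | zero =>
    obtain ⟨r, rfl⟩ : ∃ s, r = s + 1 := ⟨r - 1, by omega⟩
    have h := partialDer_eq_zero (f := f) (by simpa using hf)
    simp [biOp_succ, h]
  | succ k ih =>
    obtain ⟨r, rfl⟩ : ∃ s, r = s + 1 := ⟨r - 1, by omega⟩
    have h : ∀ a, IsHomog k (partialDer a f) := fun a => by simpa using isHomog_partialDer hf a
    simp [biOp_succ, ih (h _) (show k < r by omega)]

end

/-! ### Passage between global sections and the algebra of holomorphic functions. -/

/-- A global section of `O(k)` as a holomorphic function on `ℂ^{n+1} \ {0}`. -/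
def toHolo (n : ℕ) (k : ℤ) : H0 n k →ₗ[ℂ] puncturedHolo n where
  toFun f := ⟨f.1, by
    have h := f.2.1
    rwa [cone_top] at h⟩
  map_add' _ _ := rfl
  map_smul' _ _ := rfl

@[simp] theorem toHolo_coe {k : ℤ} (f : H0 n k) : (toHolo n k f).1 = f.1 := rfl

theorem toHolo_injective (k : ℤ) : Function.Injective (toHolo n k) := fun f g h => by
  ext1; exact congrArg (fun x => x.1) h

theorem isHomog_toHolo {k : ℤ} (f : H0 n k) : IsHomog k (toHolo n k f) := fun z hz t ht =>
  f.2.2.1 z (by rw [cone_top]; exact hz) t ht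

theorem H0_apply_zero {k : ℤ} (f : H0 n k) : f.1 0 = 0 := f.2.2.2 0 (by simp [cone_top])

/-- The matrix of the biderivation with entries in the holomorphic functions on
`ℂ^{n+1} \ {0}`. -/
def coeff (Λ : Bivector n) (a b : Fin (n + 1)) : puncturedHolo n := toHolo n 2 (Λ a b)

/-- The last index is split off because `pds` applies the last derivative of its list first; the
recursion then has the shape of `biOp_succ`. -/
theorem biPow_succ (Λ : Bivector n) (r : ℕ) (f g : Coord n → ℂ) (z : Coord n) :
    biPow Λ (r + 1) f g z = ∑ a, ∑ b, (Λ a b).1 z * biPow Λ r (pd a f) (pd b g) z := by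
  have hp : ∀ (l : List (Fin (n + 1))) (a : Fin (n + 1)) (f : Coord n → ℂ),
      pds (l ++ [a]) f = pds l (pd a f) := fun l a f => by simp [pds]
  unfold biPow
  rw [← (Fin.snocEquiv fun _ => Fin (n + 1)).sum_comp, Fintype.sum_prod_type]
  refine Finset.sum_congr rfl fun a _ => ?_
  simp_rw [← (Fin.snocEquiv fun _ : Fin (r + 1) => Fin (n + 1)).sum_comp (fun β => _ * _),
    Fintype.sum_prod_type]
  rw [Finset.sum_comm]
  refine Finset.sum_congr rfl fun b _ => ?_
  simp_rw [Finset.mul_sum]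
  refine Finset.sum_congr rfl fun α _ => Finset.sum_congr rfl fun β _ => ?_
  simp only [Fin.snocEquiv_apply, List.ofFn_succ', Fin.prod_univ_castSucc, Fin.snoc_castSucc,
    Fin.snoc_last, List.concat_eq_append, hp]
  ring

theorem biPow_congr (Λ : Bivector n) (r : ℕ) {s : Set (Coord n)} (hs : IsOpen s)
    {f f' g g' : Coord n → ℂ} (hf : Set.EqOn f f' s) (hg : Set.EqOn g g' s) :
    Set.EqOn (biPow Λ r f g) (biPow Λ r f' g') s := fun z hz => by
  simp only [biPow, pds_congr hs hf _ hz, pds_congr hs hg _ hz]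

theorem biPow_eq_biOp (Λ : Bivector n) (r : ℕ) (f g : puncturedHolo n) :
    Set.EqOn (biPow Λ r f.1 g.1) (biOp partialDer (coeff Λ) r f g).1 {0}ᶜ := fun z hz => by
  induction r generalizing f g with
  | zero => simp [biPow, pds]
  | succ r ih =>
    rw [biPow_succ, biOp_succ]
    simp only [AddSubmonoidClass.coe_finsetSum, Finset.sum_apply, MulMemClass.coe_mul,
      Pi.mul_apply, ← ih]
    refine Finset.sum_congr rfl fun a _ => Finset.sum_congr rfl fun b _ => ?_
    rw [biPow_congr Λ r isOpen_punctured (partialDer_eqOn a f) (partialDer_eqOn b g) hz]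
    rfl

theorem sharpTerm_eq_starOp (Λ : Bivector n) (r : ℕ) (f g : puncturedHolo n) :
    Set.EqOn (sharpTerm Λ r f.1 g.1) (starOp partialDer (coeff Λ) r f g).1 {0}ᶜ := fun z hz => by
  simp [sharpTerm, starOp, biPow_eq_biOp Λ r f g hz]

/-- A homogeneous holomorphic function on `ℂ^{n+1} \ {0}` as a global section. -/
def ofHolo (k : ℤ) (f : puncturedHolo n) (hf : IsHomog k f) : H0 n k :=
  ⟨({0}ᶜ : Set (Coord n)).indicator f.1, by
    refine ⟨?_, ?_, ?_⟩ <;> rw [cone_top]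
    · exact AnalyticOnNhd.congr isOpen_punctured f.2 fun _ hz => (Set.indicator_of_mem hz _).symm
    · intro z hz t ht
      have htz : t • z ∈ ({0}ᶜ : Set (Coord n)) := smul_ne_zero ht hz
      rw [Set.indicator_of_mem hz, Set.indicator_of_mem htz, hf z hz t ht]
    · exact fun z hz => Set.indicator_of_notMem hz _⟩

theorem ofHolo_eqOn (k : ℤ) (f : puncturedHolo n) (hf : IsHomog k f) :
    Set.EqOn (ofHolo k f hf).1 f.1 {0}ᶜ := fun _ hz => Set.indicator_of_mem hz _

/-! ### Coordinates and their products as test sections. -/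

/-- The homogeneous coordinate `z_a`. -/
def coordHolo (a : Fin (n + 1)) : puncturedHolo n :=
  ⟨fun z => z a,
    (ContinuousLinearMap.proj (R := ℂ) (φ := fun _ : Fin (n + 1) => ℂ) a).analyticOnNhd _⟩

theorem isHomog_coordHolo (a : Fin (n + 1)) : IsHomog 1 (coordHolo a) := fun z _ t _ => by
  simp [coordHolo]

theorem pd_coordHolo (a i : Fin (n + 1)) :
    pd i (coordHolo a).1 = fun _ => if a = i then 1 else 0 := by
  ext z
  have : fderiv ℂ (coordHolo a).1 z =
    ContinuousLinearMap.proj (R := ℂ) (φ := fun _ : Fin (n + 1) => ℂ) a :=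
      (ContinuousLinearMap.proj (R := ℂ) (φ := fun _ : Fin (n + 1) => ℂ) a).fderiv
  simp [pd, this, Pi.single_apply]

theorem pd_const (i : Fin (n + 1)) (c : ℂ) : pd i (fun _ => c) = 0 := by
  ext z; simp [pd]

/-- The homogeneous coordinate `z_a` as a section of `O(1)`. -/
def coordSection (n : ℕ) (a : Fin (n + 1)) : H0 n 1 := ofHolo 1 (coordHolo a) (isHomog_coordHolo a)

theorem pd_coordSection (a i : Fin (n + 1)) :
    Set.EqOn (pd i (coordSection n a).1) (fun _ => if a = i then 1 else 0) {0}ᶜ := by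
  rw [← pd_coordHolo]
  exact pd_congr isOpen_punctured (ofHolo_eqOn ..) i

theorem pd_pd_coordSection (a i j : Fin (n + 1)) :
    Set.EqOn (pd j (pd i (coordSection n a).1)) 0 {0}ᶜ := by
  refine (pd_congr isOpen_punctured (pd_coordSection a i) j).trans ?_
  rw [pd_const]
  exact fun _ _ => rfl

/-- The product `z_b z_c` as a section of `O(2)`. -/
def coordMulSection (n : ℕ) (b c : Fin (n + 1)) : H0 n 2 :=
  ofHolo 2 (coordHolo b * coordHolo c) ((isHomog_coordHolo b).mul (isHomog_coordHolo c))

theorem pd_coordMulSection (b c i : Fin (n + 1)) :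
    Set.EqOn (pd i (coordMulSection n b c).1)
      (fun z => (if c = i then z b else 0) + if b = i then z c else 0) {0}ᶜ := by
  refine (pd_congr isOpen_punctured (ofHolo_eqOn ..) i).trans fun z hz => ?_
  refine (pd_mul (differentiableAt_holo _ hz) (differentiableAt_holo _ hz) i).trans ?_
  rw [pd_coordHolo, pd_coordHolo]
  simp [coordHolo]

theorem pd_pd_coordMulSection (b c i j : Fin (n + 1)) :
    Set.EqOn (pd j (pd i (coordMulSection n b c).1))
      (fun _ => (if c = i ∧ b = j then 1 else 0) + if b = i ∧ c = j then 1 else 0) {0}ᶜ := by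
  refine (pd_congr isOpen_punctured (pd_coordMulSection b c i) j).trans fun z _ => ?_
  have h : (fun z : Coord n => (if c = i then z b else 0) + if b = i then z c else 0) =
      fun z => (if c = i then (1 : ℂ) else 0) * (coordHolo b).1 z +
        (if b = i then (1 : ℂ) else 0) * (coordHolo c).1 z := by
    ext z; simp [coordHolo]
  have hd : ∀ a, DifferentiableAt ℂ (coordHolo a).1 z := fun a =>
    (ContinuousLinearMap.proj (R := ℂ) (φ := fun _ : Fin (n + 1) => ℂ) a).differentiableAt
  have hp := fun a => congrFun (pd_coordHolo a j) z
  simp only [pd] at hp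
  rw [h, pd, fderiv_fun_add ((hd b).const_mul _) ((hd c).const_mul _), fderiv_const_mul (hd b),
    fderiv_const_mul (hd c)]
  simp only [add_apply, smul_apply, hp, smul_eq_mul, ite_and, ite_mul, one_mul,
    zero_mul]

/-! ### Consequences of skewness, Jacobi and the arrow relation for the coefficients. -/

theorem sum_fin_two {ι M : Type*} [Fintype ι] [AddCommMonoid M] (F : (Fin 2 → ι) → M) :
    ∑ α, F α = ∑ a, ∑ b, F ![a, b] := by
  rw [← (finTwoArrowEquiv ι).symm.sum_comp, Fintype.sum_prod_type]
  rfl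

/-- The places `0, 1, 2, 3` hold `f, Λ^{ab}, Λ^{cd}, g`. Only `←∂_c` can reach `Λ^{ab}` and only
`→∂_b` can reach `Λ^{cd}`; of these four cases the one where neither happens is `biPow`. -/
theorem arrowPow_two (Λ : Bivector n) (f g : Coord n → ℂ) (z : Coord n) :
    arrowPow Λ 2 f g z = biPow Λ 2 f g z + ∑ a, ∑ c, ∑ b, ∑ d,
      (pd a f z * pd c (Λ a b).1 z * (Λ c d).1 z * pd b (pd d g) z +
        pd a (pd c f) z * (Λ a b).1 z * pd b (Λ c d).1 z * pd d g z +
        pd a f z * pd c (Λ a b).1 z * pd b (Λ c d).1 z * pd d g z) := by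
  have hs : Fintype.piFinset (fun i : Fin 2 => Finset.Iio (mid i)) =
      {(![0, 0] : Fin 2 → Fin 4), ![0, 1]} := by decide
  have ht : Fintype.piFinset (fun i : Fin 2 => Finset.Ioi (mid i)) =
      {(![3, 3] : Fin 2 → Fin 4), ![2, 3]} := by decide
  have hs' : (![0, 0] : Fin 2 → Fin 4) ≠ ![0, 1] := by decide
  have ht' : (![3, 3] : Fin 2 → Fin 4) ≠ ![2, 3] := by decide
  unfold arrowPow biPow
  simp only [hs, ht, Finset.sum_pair hs', Finset.sum_pair ht', sum_fin_two,
    ← Finset.sum_add_distrib]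
  refine Finset.sum_congr rfl fun a _ => Finset.sum_congr rfl fun c _ =>
    Finset.sum_congr rfl fun b _ => Finset.sum_congr rfl fun d _ => ?_
  have hl : List.finRange 2 = [0, 1] := rfl
  have h2 : (Fin.cons f (Fin.snoc (fun i => (Λ (![a, c] i) (![b, d] i)).1) g :
      Fin 3 → Coord n → ℂ) : Fin 4 → Coord n → ℂ) 2 = (Λ c d).1 := rfl
  have h3 : (Fin.cons f (Fin.snoc (fun i => (Λ (![a, c] i) (![b, d] i)).1) g :
      Fin 3 → Coord n → ℂ) : Fin 4 → Coord n → ℂ) 3 = g := rfl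
  simp [Fin.prod_univ_four, hl, pds, List.ofFn_succ, h2, h3]
  ring

theorem bracket_coordSection_left (Λ : Bivector n) (a : Fin (n + 1)) (g : Coord n → ℂ) :
    Set.EqOn (bracket Λ (coordSection n a).1 g) (fun z => ∑ e, (Λ a e).1 z * pd e g z) {0}ᶜ := by
  intro z hz
  simp only [bracket, pd_coordSection a _ hz]
  rw [Finset.sum_eq_single a (fun i _ hi => by simp [hi.symm]) (by simp)]
  simp

theorem bracket_coordSection (Λ : Bivector n) (a b : Fin (n + 1)) :
    Set.EqOn (bracket Λ (coordSection n a).1 (coordSection n b).1) (Λ a b).1 {0}ᶜ := by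
  intro z hz
  rw [bracket_coordSection_left Λ a _ hz]
  simp [pd_coordSection b _ hz]

theorem IsSkew.apply_eq_neg {Λ : Bivector n} (h : IsSkew Λ) (a b : Fin (n + 1)) :
    Λ a b = -Λ b a := by
  ext z
  by_cases hz : z = 0
  · simp [hz, H0_apply_zero]
  · have := h ⊤ 1 1 (coordSection n a) (coordSection n b) z (by rw [cone_top]; exact hz)
    rw [bracket_coordSection Λ a b hz, bracket_coordSection Λ b a hz] at this
    simpa using this

/-- The derivative of the coefficients along the Hamiltonian vector fields of the coordinates. -/
def coeffDer (Λ : Bivector n) (a b c : Fin (n + 1)) (z : Coord n) : ℂ :=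
  ∑ e, (Λ a e).1 z * pd e (Λ b c).1 z

theorem IsJacobi.coeffDer_cyclic {Λ : Bivector n} (h : IsJacobi Λ) (a b c : Fin (n + 1))
    {z : Coord n} (hz : z ≠ 0) :
    coeffDer Λ a b c z + coeffDer Λ b c a z + coeffDer Λ c a b z = 0 := by
  have h1 := h ⊤ 1 1 1 (coordSection n a) (coordSection n b) (coordSection n c) z
    (by rw [cone_top]; exact hz)
  have h2 : ∀ a b c, bracket Λ (coordSection n a).1
      (bracket Λ (coordSection n b).1 (coordSection n c).1) z = coeffDer Λ a b c z := by
    intro a b c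
    rw [bracket_coordSection_left Λ a _ hz]
    exact Finset.sum_congr rfl fun e _ => by
      rw [pd_congr isOpen_punctured (bracket_coordSection Λ b c) e hz]
  rwa [h2, h2, h2] at h1

theorem IsSkew.coeffDer_swap {Λ : Bivector n} (h : IsSkew Λ) (a b c : Fin (n + 1)) (z : Coord n) :
    coeffDer Λ a b c z = -coeffDer Λ a c b z := by
  simp only [coeffDer, ← Finset.sum_neg_distrib]
  refine Finset.sum_congr rfl fun e _ => ?_
  have : (Λ b c).1 = -(Λ c b).1 := congrArg (fun x => x.1) (h.apply_eq_neg b c)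
  simp [this, pd, fderiv_neg]

/-- Taking `f = z_a` kills its second derivatives, so two of the three correction terms remain. -/
theorem HasArrowRelation.sum_eq_zero {Λ : Bivector n} (h : HasArrowRelation Λ)
    (a : Fin (n + 1)) {k : ℤ} (g : H0 n k) {z : Coord n} (hz : z ≠ 0) :
    ∑ c, ∑ b, ∑ d, (pd c (Λ a b).1 z * (Λ c d).1 z * pd b (pd d g.1) z +
        pd c (Λ a b).1 z * pd b (Λ c d).1 z * pd d g.1 z) = 0 := by
  have h1 := h 2 ⊤ 1 k (coordSection n a) g z (by rw [cone_top]; exact hz)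
  rw [arrowPow_two, add_eq_left] at h1
  simp only [pd_pd_coordSection a _ _ hz, pd_coordSection a _ hz] at h1
  rw [Finset.sum_eq_single a (fun i _ hi => by simp [hi.symm]) (by simp)] at h1
  simpa using h1

theorem HasArrowRelation.sum_pd_mul_pd {Λ : Bivector n} (h : HasArrowRelation Λ)
    (a b : Fin (n + 1)) {z : Coord n} (hz : z ≠ 0) :
    ∑ c, ∑ e, pd c (Λ a e).1 z * pd e (Λ c b).1 z = 0 := by
  have h1 := h.sum_eq_zero a (coordSection n b) hz
  simp only [pd_pd_coordSection b _ _ hz, pd_coordSection b _ hz] at h1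
  simpa using h1

/-- With `g = z_b z_c` the terms in first derivatives of `g` are multiples of `sum_pd_mul_pd` and
drop out; the Hessian of `g` leaves a sum symmetrized in `b, c`. -/
theorem HasArrowRelation.sum_pd_mul {Λ : Bivector n} (h : HasArrowRelation Λ)
    (a b c : Fin (n + 1)) {z : Coord n} (hz : z ≠ 0) :
    ∑ e, pd e (Λ a b).1 z * (Λ e c).1 z + ∑ e, pd e (Λ a c).1 z * (Λ e b).1 z = 0 := by
  have h1 := h.sum_eq_zero a (coordMulSection n b c) hz
  simp only [pd_pd_coordMulSection b c _ _ hz, pd_coordMulSection b c _ hz] at h1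
  have h2 := h.sum_pd_mul_pd a b hz
  have h3 := h.sum_pd_mul_pd a c hz
  simp only [ite_and, mul_add, mul_ite, mul_one, mul_zero, Finset.sum_add_distrib,
    Finset.sum_ite_eq, Finset.mem_univ, if_true] at h1
  simp only [← Finset.sum_mul, h2, h3] at h1
  simpa using h1

/-- The coefficients are annihilated by the Hamiltonian vector fields of the coordinates. -/
theorem coeffDer_eq_zero {Λ : Bivector n} (hskew : IsSkew Λ) (hjacobi : IsJacobi Λ)
    (hrel : HasArrowRelation Λ) (a b c : Fin (n + 1)) {z : Coord n} (hz : z ≠ 0) :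
    coeffDer Λ a b c z = 0 := by
  have h1 : ∀ a b c, coeffDer Λ c a b z = -coeffDer Λ b a c z := by
    intro a b c
    have h := hrel.sum_pd_mul a b c hz
    have h2 : ∀ b c, ∑ e, pd e (Λ a b).1 z * (Λ e c).1 z = -coeffDer Λ c a b z := by
      intro b c
      simp only [coeffDer, ← Finset.sum_neg_distrib]
      refine Finset.sum_congr rfl fun e _ => ?_
      rw [hskew.apply_eq_neg e c]
      simp only [NegMemClass.coe_neg, Pi.neg_apply]
      ring
    rw [h2, h2] at h
    linear_combination -h
  have h3 := hjacobi.coeffDer_cyclic a b c hz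
  have h4 := h1 c a b
  have h5 := hskew.coeffDer_swap a c b z
  have h6 := h1 b a c
  have h7 := hskew.coeffDer_swap c b a z
  -- The two antisymmetries make the three cyclic terms equal.
  linear_combination (1 / 3 : ℂ) * (h3 - h4 + h5 - h7 + h6)

/-! ### Formal expressions in `μ`: finiteness, convolution and substitution. -/

theorem finite_support_of_imp {α M : Type*} [Zero M] {f : α → M} {s : Set α} (hs : s.Finite)
    (h : ∀ x, f x ≠ 0 → x ∈ s) : f.HasFiniteSupport := hs.subset h

theorem linearMap_map_finsum {α M N : Type*} [AddCommGroup M] [Module ℂ M] [AddCommGroup N]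
    [Module ℂ N] (T : M →ₗ[ℂ] N) {f : α → M} (hf : f.HasFiniteSupport) :
    T (∑ᶠ i, f i) = ∑ᶠ i, T (f i) := T.toAddMonoidHom.map_finsum hf

/-- The bound `K` matters for series in `μ⁻¹`, where large `r` could otherwise compensate
arbitrarily negative exponents. -/
theorem FormalKind.Allows.finite_pairs {ν : FormalKind} {s t : Set ℤ} (hs : ν.Allows s)
    (ht : ν.Allows t) (K : ℕ) (m : ℤ) :
    {p : ℕ × ℤ | p.1 ≤ K ∧ p.2 ∈ s ∧ m - p.1 - p.2 ∈ t}.Finite := by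
  cases ν
  · exact ((Set.finite_Iic K).prod hs).subset fun p hp => ⟨hp.1, hp.2.1⟩
  · obtain ⟨A, hA⟩ := hs
    obtain ⟨B, hB⟩ := ht
    refine ((Set.finite_Iic K).prod (Set.finite_Icc (m - K - B) A)).subset fun p hp => ?_
    have h1 := hp.1
    have h2 := hA hp.2.1
    have h3 := hB hp.2.2
    exact ⟨h1, by omega, h2⟩
  · obtain ⟨A, hA⟩ := hs
    obtain ⟨B, hB⟩ := ht
    refine ((Set.finite_Iic K).prod (Set.finite_Icc A (m - B))).subset fun p hp => ?_
    have h1 := hp.1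
    have h2 := hA hp.2.1
    have h3 := hB hp.2.2
    exact ⟨h1, h2, by omega⟩

theorem FormalKind.Allows.finite_triples {ν : FormalKind} {s t u : Set ℤ} (hs : ν.Allows s)
    (ht : ν.Allows t) (hu : ν.Allows u) (K : ℕ) (m : ℤ) :
    {q : (ℤ × ℤ) × ℕ × ℕ | (q.2.1 ≤ K ∧ q.2.2 ≤ K) ∧ q.1.1 ∈ s ∧ q.1.2 ∈ t ∧
      m - (q.2.1 + q.2.2 : ℕ) - q.1.1 - q.1.2 ∈ u}.Finite := by
  have hK := (Set.finite_Iic K).prod (Set.finite_Iic K)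
  cases ν
  · exact ((hs.prod ht).prod hK).subset fun p hp => ⟨⟨hp.2.1, hp.2.2.1⟩, hp.1⟩
  · obtain ⟨A, hA⟩ := hs
    obtain ⟨B, hB⟩ := ht
    obtain ⟨C, hC⟩ := hu
    refine ((((Set.finite_Icc (m - K - K - B - C) A)).prod
      (Set.finite_Icc (m - K - K - A - C) B)).prod hK).subset fun p hp => ?_
    have h0 := hp.1
    have h1 := hA hp.2.1
    have h2 := hB hp.2.2.1
    have h3 := hC hp.2.2.2
    push_cast at h3
    exact ⟨⟨⟨by omega, h1⟩, by omega, h2⟩, h0⟩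
  · obtain ⟨A, hA⟩ := hs
    obtain ⟨B, hB⟩ := ht
    obtain ⟨C, hC⟩ := hu
    refine ((((Set.finite_Icc A (m - B - C))).prod
      (Set.finite_Icc B (m - A - C))).prod hK).subset fun p hp => ?_
    have h0 := hp.1
    have h1 := hA hp.2.1
    have h2 := hB hp.2.2.1
    have h3 := hC hp.2.2.2
    push_cast at h3
    exact ⟨⟨⟨h1, by omega⟩, h2, by omega⟩, h0⟩

theorem FormalKind.Allows.sums {ν : FormalKind} {s t : Set ℤ} (hs : ν.Allows s)
    (ht : ν.Allows t) (K : ℕ) :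
    ν.Allows {m | ∃ p : ℕ × ℤ, p.1 ≤ K ∧ p.2 ∈ s ∧ m - p.1 - p.2 ∈ t} := by
  cases ν
  · refine (((Set.finite_Iic K).prod (hs.prod ht)).image
      fun q => (q.1 : ℤ) + q.2.1 + q.2.2).subset ?_
    rintro m ⟨p, h1, h2, h3⟩
    exact ⟨(p.1, p.2, m - p.1 - p.2), ⟨h1, h2, h3⟩, by simp⟩
  · obtain ⟨A, hA⟩ := hs
    obtain ⟨B, hB⟩ := ht
    refine ⟨K + A + B, ?_⟩
    rintro m ⟨p, h1, h2, h3⟩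
    have h2 := hA h2
    have h3 := hB h3
    omega
  · obtain ⟨A, hA⟩ := hs
    obtain ⟨B, hB⟩ := ht
    refine ⟨A + B, ?_⟩
    rintro m ⟨p, h1, h2, h3⟩
    have h2 := hA h2
    have h3 := hB h3
    omega

section Convolution

variable {M N P : Type*} [AddCommGroup M] [Module ℂ M] [AddCommGroup N] [Module ℂ N]
  [AddCommGroup P] [Module ℂ P]

/-- The coefficient of `μ ^ m` in the product of `∑ a_i μ ^ i` and `∑ b_j μ ^ j` under
`∑ μ ^ r T_r`. -/
def conv (T : ℕ → M →ₗ[ℂ] N →ₗ[ℂ] P) (a : ℤ → M) (b : ℤ → N) (m : ℤ) : P :=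
  ∑ᶠ p : ℕ × ℤ, T p.1 (a p.2) (b (m - p.1 - p.2))

theorem conv_finite {ν : FormalKind} {T : ℕ → M →ₗ[ℂ] N →ₗ[ℂ] P} {K : ℕ} {a : ℤ → M} {b : ℤ → N}
    (ha : ν.Allows (Function.support a)) (hb : ν.Allows (Function.support b))
    (hT : ∀ r, K < r → ∀ i j, T r (a i) (b j) = 0) (m : ℤ) :
    (fun p : ℕ × ℤ => T p.1 (a p.2) (b (m - p.1 - p.2))).HasFiniteSupport :=
  finite_support_of_imp (ha.finite_pairs hb K m) fun p hp =>
    ⟨not_lt.1 fun h => hp (hT _ h _ _), fun h => hp (by simp [h]), fun h => hp (by simp [h])⟩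

/-- The product of formal expressions under `∑ μ ^ r T_r`, where `T_r = 0` for large `r`. -/
def formalMul (ν : FormalKind) (T : ℕ → M →ₗ[ℂ] N →ₗ[ℂ] P) (K : ℕ) (hT : ∀ r, K < r → T r = 0) :
    Formal ν M →ₗ[ℂ] Formal ν N →ₗ[ℂ] Formal ν P :=
  have hf : ∀ (a : Formal ν M) (b : Formal ν N) m,
      (fun p : ℕ × ℤ => T p.1 (a.1 p.2) (b.1 (m - p.1 - p.2))).HasFiniteSupport := fun a b m =>
    conv_finite a.2 b.2 (K := K) (fun r hr i j => by simp [hT r hr]) m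
  LinearMap.mk₂ ℂ (fun a b => ⟨conv T a.1 b.1, (FormalKind.Allows.sums a.2 b.2 K).mono (by
      intro m hm
      obtain ⟨p, hp⟩ : ∃ p : ℕ × ℤ, T p.1 (a.1 p.2) (b.1 (m - p.1 - p.2)) ≠ 0 := by
        by_contra! h
        exact hm (finsum_eq_zero_of_forall_eq_zero h)
      exact ⟨p, not_lt.1 fun h => hp (by simp [hT _ h]), fun h => hp (by simp [h]),
        fun h => hp (by simp [h])⟩)⟩)
    (fun a a' b => by
      ext m
      simpa [conv] using finsum_add_distrib (hf a b m) (hf a' b m))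
    (fun c a b => by
      ext m
      simp [conv, smul_finsum])
    (fun a b b' => by
      ext m
      simpa [conv] using finsum_add_distrib (hf a b m) (hf a b' m))
    (fun c a b => by
      ext m
      simp [conv, smul_finsum])

theorem formalMul_coe (ν : FormalKind) (T : ℕ → M →ₗ[ℂ] N →ₗ[ℂ] P) (K : ℕ)
    (hT : ∀ r, K < r → T r = 0) (a : Formal ν M) (b : Formal ν N) :
    (formalMul ν T K hT a b).1 = conv T a.1 b.1 := rfl

/-- The product under `∑ c ^ r T_r`, where `T_r = 0` for large `r`. -/
def scalarMul (T : ℕ → M →ₗ[ℂ] N →ₗ[ℂ] P) (K : ℕ) (c : ℂ) : M →ₗ[ℂ] N →ₗ[ℂ] P :=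
  ∑ r ∈ Finset.range (K + 1), c ^ r • T r

theorem scalarMul_apply {T : ℕ → M →ₗ[ℂ] N →ₗ[ℂ] P} {K : ℕ} (hT : ∀ r, K < r → T r = 0) (c : ℂ)
    (x : M) (y : N) : scalarMul T K c x y = ∑ᶠ r, c ^ r • T r x y := by
  rw [finsum_eq_sum_of_support_subset (s := Finset.range (K + 1))]
  · simp [scalarMul, LinearMap.sum_apply]
  · intro r hr
    simp only [Finset.coe_range, Set.mem_Iio, Nat.lt_succ_iff]
    exact not_lt.1 fun h => hr (by simp [hT r h])

/-- Substituting a scalar for `μ` is compatible with the products. -/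
theorem evalMu_formalMul (T : ℕ → M →ₗ[ℂ] N →ₗ[ℂ] P) (K : ℕ) (hT : ∀ r, K < r → T r = 0) {c : ℂ}
    (hc : c ≠ 0) (a : Formal .laurentPolynomial M) (b : Formal .laurentPolynomial N) :
    evalMu c P (formalMul .laurentPolynomial T K hT a b) =
      scalarMul T K c (evalMu c M a) (evalMu c N b) := by
  have ha : (Function.support a.1).Finite := a.2
  have hb : (Function.support b.1).Finite := b.2
  have ha' : (fun i : ℤ => c ^ i • a.1 i).HasFiniteSupport :=
    finite_support_of_imp ha fun i hi h => hi (by simp [h])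
  have hb' : (fun i : ℤ => c ^ i • b.1 i).HasFiniteSupport :=
    finite_support_of_imp hb fun i hi h => hi (by simp [h])
  -- Both sides are the sum of `F` over triples `(r, i, j)`; `e` below replaces `j` by the total
  -- exponent `r + i + j`.
  let F : ℕ × ℤ × ℤ → P := fun q => c ^ ((q.1 : ℤ) + q.2.1 + q.2.2) • T q.1 (a.1 q.2.1) (b.1 q.2.2)
  have hF : F.HasFiniteSupport :=
    finite_support_of_imp ((Set.finite_Iic K).prod (ha.prod hb)) fun q hq =>
      ⟨Set.mem_Iic.2 (not_lt.1 fun h => hq (by simp [F, hT _ h])),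
        fun h => hq (by simp [F, h]), fun h => hq (by simp [F, h])⟩
  let e : ℤ × ℕ × ℤ ≃ ℕ × ℤ × ℤ :=
    { toFun q := (q.2.1, q.2.2, q.1 - q.2.1 - q.2.2)
      invFun q := (q.1 + q.2.1 + q.2.2, q.1, q.2.1)
      left_inv q := by ext <;> simp
      right_inv q := by ext <;> simp; ring }
  trans ∑ᶠ q, F q
  · rw [← finsum_comp_equiv e, finsum_curry _ (hF.fun_comp_of_injective e.injective)]
    refine finsum_congr fun m => ?_
    rw [formalMul_coe, conv, smul_finsum]
    refine finsum_congr fun p => ?_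
    simp [F, e]
  · rw [scalarMul_apply hT, finsum_curry₃ _ hF]
    refine finsum_congr fun r => ?_
    have h1 : evalMu c M a = ∑ᶠ i : ℤ, c ^ i • a.1 i := rfl
    have h2 : evalMu c N b = ∑ᶠ i : ℤ, c ^ i • b.1 i := rfl
    have h3 : T r (∑ᶠ i : ℤ, c ^ i • a.1 i) (∑ᶠ j : ℤ, c ^ j • b.1 j) =
        ∑ᶠ i : ℤ, T r (c ^ i • a.1 i) (∑ᶠ j : ℤ, c ^ j • b.1 j) :=
      linearMap_map_finsum ((T r).flip _) ha'
    rw [h1, h2, h3, smul_finsum]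
    refine finsum_congr fun i => ?_
    rw [linearMap_map_finsum _ hb', smul_finsum]
    refine finsum_congr fun j => ?_
    simp only [F, map_smul, LinearMap.smul_apply, smul_smul]
    rw [zpow_add₀ hc, zpow_add₀ hc, zpow_natCast]
    congr 1
    ring

end Convolution

/-! ### From associativity in each order of `μ` to associativity of the summed products. -/

section Associativity

variable {V : Type*} [AddCommGroup V] [Module ℂ V] {S : ℕ → V →ₗ[ℂ] V →ₗ[ℂ] V}

/-- Associativity degree by degree, summed up with arbitrary weights. -/
theorem finsum_assoc (hS : ∀ m x y w, ∑ p ∈ Finset.HasAntidiagonal.antidiagonal m,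
      S p.2 (S p.1 x y) w = ∑ p ∈ Finset.HasAntidiagonal.antidiagonal m, S p.2 x (S p.1 y w))
    {K : ℕ} {x y : V} (w : ℕ → V) (h1 : ∀ r s u, (K < r ∨ K < s) → S s (S r x y) u = 0)
    (h2 : ∀ r s u, (K < r ∨ K < s) → S s x (S r y u) = 0) :
    ∑ᶠ p : ℕ × ℕ, S p.2 (S p.1 x y) (w (p.1 + p.2)) =
      ∑ᶠ p : ℕ × ℕ, S p.2 x (S p.1 y (w (p.1 + p.2))) := by
  classical
  -- The weight depends only on `p.1 + p.2`, so terms are grouped by antidiagonals; those up to `2 *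
  -- K` cover the square that carries the support.
  let B : Finset (ℕ × ℕ) :=
    (Finset.range (2 * K + 1)).biUnion fun m => Finset.HasAntidiagonal.antidiagonal m
  have hB : ∀ p : ℕ × ℕ, ¬(K < p.1 ∨ K < p.2) → p ∈ B := fun p hp => by
    simp only [B, Finset.mem_biUnion, Finset.mem_range, Finset.HasAntidiagonal.mem_antidiagonal]
    exact ⟨p.1 + p.2, by omega, rfl⟩
  have hd : (↑(Finset.range (2 * K + 1)) : Set ℕ).PairwiseDisjoint
      fun m : ℕ => Finset.HasAntidiagonal.antidiagonal m := fun m _ m' _ hm =>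
    Finset.disjoint_left.2 fun p hp hp' => hm (by
      rw [← Finset.HasAntidiagonal.mem_antidiagonal.1 hp,
        ← Finset.HasAntidiagonal.mem_antidiagonal.1 hp'])
  rw [finsum_eq_sum_of_support_subset (s := B) _ fun p hp => hB p fun h => hp (h1 _ _ _ h),
    finsum_eq_sum_of_support_subset (s := B) _ fun p hp => hB p fun h => hp (h2 _ _ _ h),
    Finset.sum_biUnion hd, Finset.sum_biUnion hd]
  refine Finset.sum_congr rfl fun m _ => ?_
  refine Eq.trans ?_ ((hS m x y (w m)).trans ?_) <;>
  exact Finset.sum_congr rfl fun p hp => by rw [Finset.HasAntidiagonal.mem_antidiagonal.1 hp]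

/-- Both sides unfold to sums over exponents `(i, j)` and over inner and outer orders `(r, s)`, the
exponent of the third factor being determined by `m`. For fixed `(i, j)` the sums over `(r, s)`
agree by `finsum_assoc`, with the coefficients of `c` as weights. -/
theorem conv_assoc (hS : ∀ m x y w, ∑ p ∈ Finset.HasAntidiagonal.antidiagonal m,
      S p.2 (S p.1 x y) w = ∑ p ∈ Finset.HasAntidiagonal.antidiagonal m, S p.2 x (S p.1 y w))
    {ν : FormalKind} {K : ℕ} {a b c : ℤ → V} (ha : ν.Allows (Function.support a))
    (hb : ν.Allows (Function.support b)) (hc : ν.Allows (Function.support c))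
    (h1 : ∀ r i u, K < r → S r (a i) u = 0) (h2 : ∀ r i u, K < r → S r (b i) u = 0)
    (h3 : ∀ r s i j u, K < s → S s (S r (a i) (b j)) u = 0) (m : ℤ) :
    conv S (conv S a b) c m = conv S a (conv S b c) m := by
  let F : (ℤ × ℤ) × ℕ × ℕ → V := fun q =>
    S q.2.2 (S q.2.1 (a q.1.1) (b q.1.2)) (c (m - (q.2.1 + q.2.2 : ℕ) - q.1.1 - q.1.2))
  let G : (ℤ × ℤ) × ℕ × ℕ → V := fun q =>
    S q.2.2 (a q.1.1) (S q.2.1 (b q.1.2) (c (m - (q.2.1 + q.2.2 : ℕ) - q.1.1 - q.1.2)))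
  have hF : F.HasFiniteSupport := finite_support_of_imp (ha.finite_triples hb hc K m) fun q hq =>
    ⟨⟨not_lt.1 fun h => hq (by simp [F, h1 _ _ _ h]), not_lt.1 fun h => hq (h3 _ _ _ _ _ h)⟩,
      fun h => hq (by simp [F, h]), fun h => hq (by simp [F, h]),
      fun h => hq (by simp only [F, h, map_zero])⟩
  have hG : G.HasFiniteSupport := finite_support_of_imp (ha.finite_triples hb hc K m) fun q hq =>
    ⟨⟨not_lt.1 fun h => hq (by simp [G, h2 _ _ _ h]), not_lt.1 fun h => hq (h1 _ _ _ h)⟩,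
      fun h => hq (by simp [G, h]), fun h => hq (by simp [G, h]),
      fun h => hq (by simp only [G, h, map_zero])⟩
  -- The source is `((s, i'), (r, i))` with `i'` the exponent of the inner product, whence `j = i' -
  -- r - i`.
  let e : (ℕ × ℤ) × ℕ × ℤ ≃ (ℤ × ℤ) × ℕ × ℕ :=
    { toFun q := ((q.2.2, q.1.2 - q.2.1 - q.2.2), q.2.1, q.1.1)
      invFun q := ((q.2.2, q.2.1 + q.1.1 + q.1.2), q.2.1, q.1.1)
      left_inv q := by ext <;> simp
      right_inv q := by ext <;> simp; ring }
  let e' : (ℕ × ℤ) × ℕ × ℤ ≃ (ℤ × ℤ) × ℕ × ℕ :=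
    { toFun q := ((q.1.2, q.2.2), q.2.1, q.1.1)
      invFun q := ((q.2.2, q.1.1), q.2.1, q.1.2)
      left_inv q := rfl
      right_inv q := rfl }
  trans ∑ᶠ q, F q
  · rw [← finsum_comp_equiv e, finsum_curry _ (hF.fun_comp_of_injective e.injective)]
    refine finsum_congr fun p => ?_
    refine (linearMap_map_finsum ((S p.1).flip (c (m - p.1 - p.2)))
      (conv_finite ha hb (K := K) (fun r hr i j => h1 r _ _ hr) p.2)).trans <|
      finsum_congr fun p' => ?_
    simp only [F, e, Equiv.coe_fn_mk, LinearMap.flip_apply]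
    congr 2
    push_cast
    ring
  trans ∑ᶠ q, G q
  · rw [finsum_curry _ hF, finsum_curry _ hG]
    refine finsum_congr fun q => ?_
    refine finsum_assoc hS (K := K) (x := a q.1) (y := b q.2)
      (fun N => c (m - N - q.1 - q.2)) ?_ ?_
    · rintro r s u (h | h)
      · simp [h1 _ _ _ h]
      · exact h3 _ _ _ _ _ h
    · rintro r s u (h | h)
      · simp [h2 _ _ _ h]
      · exact h1 _ _ _ h
  · rw [← finsum_comp_equiv e', finsum_curry _ (hG.fun_comp_of_injective e'.injective)]
    refine finsum_congr fun p => ?_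
    rw [conv, linearMap_map_finsum _ (conv_finite hb hc (K := K) (fun r hr i j => h2 r _ _ hr) _)]
    refine finsum_congr fun p' => ?_
    simp only [G, e', Equiv.coe_fn_mk]
    congr 3
    push_cast
    ring_nf

theorem finsum_scalar_assoc (hS : ∀ m x y w, ∑ p ∈ Finset.HasAntidiagonal.antidiagonal m,
      S p.2 (S p.1 x y) w = ∑ p ∈ Finset.HasAntidiagonal.antidiagonal m, S p.2 x (S p.1 y w))
    {K : ℕ} {x y : V} (c : ℂ) (w : V) (h1 : ∀ r u, K < r → S r x u = 0)
    (h2 : ∀ r u, K < r → S r y u = 0) (h3 : ∀ r s u, K < s → S s (S r x y) u = 0) :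
    ∑ᶠ s, c ^ s • S s (∑ᶠ r, c ^ r • S r x y) w =
      ∑ᶠ s, c ^ s • S s x (∑ᶠ r, c ^ r • S r y w) := by
  have hK := (Set.finite_Iic K).prod (Set.finite_Iic K)
  have hfin : ∀ {f : ℕ → V}, (∀ r, K < r → f r = 0) →
      (fun r => c ^ r • f r).HasFiniteSupport := fun {f} hf =>
    finite_support_of_imp (Set.finite_Iic K) fun r hr =>
      Set.mem_Iic.2 (not_lt.1 fun h => hr (by simp [hf r h]))
  have h := finsum_assoc hS (K := K) (x := x) (y := y) (fun N => c ^ N • w)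
    (by rintro r s u (h | h)
        · simp [h1 _ _ h]
        · exact h3 _ _ _ h)
    (by rintro r s u (h | h)
        · simp [h2 _ _ h]
        · exact h1 _ _ h)
  -- The swap puts the order of the outer product in the outer sum.
  rw [← finsum_comp_equiv (Equiv.prodComm ℕ ℕ), finsum_curry, ← finsum_comp_equiv
    (Equiv.prodComm ℕ ℕ) (f := fun p : ℕ × ℕ => S p.2 x _), finsum_curry] at h
  · convert h using 1
    · refine finsum_congr fun s => ?_
      have h4 : S s (∑ᶠ r, c ^ r • S r x y) w = ∑ᶠ r, S s (c ^ r • S r x y) w :=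
        linearMap_map_finsum ((S s).flip w) (hfin fun r hr => h1 r y hr)
      rw [h4, smul_finsum]
      refine finsum_congr fun r => ?_
      simp only [map_smul, LinearMap.smul_apply, smul_smul, Equiv.prodComm_apply, Prod.swap_prod_mk,
        pow_add, mul_comm]
    · refine finsum_congr fun s => ?_
      rw [linearMap_map_finsum _ (hfin fun r hr => h2 r w hr), smul_finsum]
      refine finsum_congr fun r => ?_
      simp only [map_smul, smul_smul, Equiv.prodComm_apply, Prod.swap_prod_mk, pow_add, mul_comm]
  · refine finite_support_of_imp hK fun p hp => ⟨?_, ?_⟩ <;>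
      refine Set.mem_Iic.2 (not_lt.1 fun h => hp ?_)
    · exact h1 _ _ h
    · simp [h2 _ _ h]
  · refine finite_support_of_imp hK fun p hp => ⟨?_, ?_⟩ <;>
      refine Set.mem_Iic.2 (not_lt.1 fun h => hp ?_)
    · exact h3 _ _ _ h
    · simp [h1 _ _ h]

end Associativity

/-! ### Products on a direct sum from products of the components. -/

section GradedProduct

variable {M : ℕ → Type*} [∀ k, AddCommGroup (M k)] [∀ k, Module ℂ (M k)]

/-- The product on a direct sum given by bilinear maps on the homogeneous components. -/
def gradedMul (P : ∀ k l, M k →ₗ[ℂ] M l →ₗ[ℂ] M (k + l)) :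
    (⨁ k, M k) →ₗ[ℂ] (⨁ k, M k) →ₗ[ℂ] ⨁ k, M k :=
  DirectSum.toModule ℂ ℕ _ fun k => LinearMap.flip <| DirectSum.toModule ℂ ℕ _ fun l =>
    LinearMap.flip <| (P k l).compr₂ (DirectSum.lof ℂ ℕ M (k + l))

theorem gradedMul_lof (P : ∀ k l, M k →ₗ[ℂ] M l →ₗ[ℂ] M (k + l)) (k l : ℕ) (x : M k) (y : M l) :
    gradedMul P (DirectSum.lof ℂ ℕ M k x) (DirectSum.lof ℂ ℕ M l y) =
      DirectSum.lof ℂ ℕ M (k + l) (P k l x y) := by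
  simp [gradedMul]

theorem gradedMul_assoc {P : ∀ k l, M k →ₗ[ℂ] M l →ₗ[ℂ] M (k + l)}
    (h : ∀ k l m x y w, DirectSum.lof ℂ ℕ M (k + l + m) (P (k + l) m (P k l x y) w) =
      DirectSum.lof ℂ ℕ M (k + (l + m)) (P k (l + m) x (P l m y w))) (x y w : ⨁ k, M k) :
    gradedMul P (gradedMul P x y) w = gradedMul P x (gradedMul P y w) := by
  induction x using DirectSum.induction_on with
  | zero => simp
  | add x x' hx hx' => simp only [map_add, LinearMap.add_apply, hx, hx']
  | of k x =>
  induction y using DirectSum.induction_on with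
  | zero => simp
  | add y y' hy hy' => simp only [map_add, LinearMap.add_apply, hy, hy']
  | of l y =>
  induction w using DirectSum.induction_on with
  | zero => simp
  | add w w' hw hw' => simp only [map_add, hw, hw']
  | of m w =>
    simp only [← DirectSum.lof_eq_of ℂ, gradedMul_lof, h]

end GradedProduct

/-! ### The product `#` on global sections. -/

theorem biOp_apply_zero (Λ : Bivector n) (r : ℕ) {f g : puncturedHolo n} (hf : f.1 0 = 0) :
    (biOp partialDer (coeff Λ) r f g).1 0 = 0 := by
  cases r with
  | zero => simp [hf]
  | succ r =>
    have h : ∀ a b, (coeff Λ a b).1 0 = 0 := fun a b => H0_apply_zero (Λ a b)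
    simp [biOp_succ, h]

theorem isHomog_starOp (Λ : Bivector n) (r : ℕ) {k l : ℤ} {f g : puncturedHolo n}
    (hf : IsHomog k f) (hg : IsHomog l g) :
    IsHomog (k + l) (starOp partialDer (coeff Λ) r f g) :=
  (isHomog_biOp (fun a b => isHomog_toHolo (Λ a b)) r hf hg).smul _

/-- The coefficient of `μ ^ r` in `f # g`, for global sections `f` and `g`. -/
def sharpOp (Λ : Bivector n) (k l r : ℕ) :
    H0 n (k : ℤ) →ₗ[ℂ] H0 n (l : ℤ) →ₗ[ℂ] H0 n ((k + l : ℕ) : ℤ) :=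
  LinearMap.mk₂ ℂ (fun f g => ⟨(starOp partialDer (coeff Λ) r (toHolo n k f) (toHolo n l g)).1, by
      have h := isHomog_starOp Λ r (isHomog_toHolo f) (isHomog_toHolo g)
      refine ⟨?_, ?_, ?_⟩ <;> rw [cone_top]
      · exact (starOp partialDer (coeff Λ) r (toHolo n k f) (toHolo n l g)).2
      · intro z hz t ht
        rw [h z hz t ht]
        push_cast
        rfl
      · intro z hz
        obtain rfl : z = 0 := by simpa using hz
        simp [starOp, biOp_apply_zero Λ r (f := toHolo n k f) (H0_apply_zero f)]⟩)
    (fun f f' g => by ext1; simp) (fun c f g => by ext1; simp)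
    (fun f g g' => by ext1; simp) (fun c f g => by ext1; simp)

theorem toHolo_sharpOp (Λ : Bivector n) (k l r : ℕ) (f : H0 n (k : ℤ)) (g : H0 n (l : ℤ)) :
    toHolo n _ (sharpOp Λ k l r f g) =
      starOp partialDer (coeff Λ) r (toHolo n k f) (toHolo n l g) := rfl

theorem starOp_left_eq_zero (Λ : Bivector n) {k : ℕ} {f : puncturedHolo n} (hf : IsHomog k f)
    {r : ℕ} (hr : k < r) (g : puncturedHolo n) : starOp partialDer (coeff Λ) r f g = 0 := by
  simp [starOp, biOp_left_eq_zero hf hr]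

theorem sharpOp_eq_zero (Λ : Bivector n) (k l r : ℕ) (hr : k < r) : sharpOp Λ k l r = 0 := by
  ext1 f
  ext1 g
  exact toHolo_injective _ (starOp_left_eq_zero Λ (isHomog_toHolo f) hr _)

/-- Derivatives at a point of the open cone depend only on germs, so restriction does not affect
them. -/
theorem sharpTerm_res (Λ : Bivector n) (k l r : ℕ) (f : H0 n (k : ℤ)) (g : H0 n (l : ℤ))
    (U : Opens (CP n)) {z : Coord n} (hz : z ∈ cone U) :
    sharpTerm Λ r (res le_top f : twist n k U).1 (res le_top g : twist n l U).1 z =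
      (sharpOp Λ k l r f g).1 z := by
  have hz0 : z ∈ ({0}ᶜ : Set (Coord n)) := hz.1
  have h : ∀ {k : ℤ} (f : H0 n k), Set.EqOn (res le_top f : twist n k U).1 f.1 (cone U) :=
    fun f _ hw => Set.indicator_of_mem hw _
  refine Eq.trans ?_ (sharpTerm_eq_starOp Λ r (toHolo n k f) (toHolo n l g) hz0)
  simp only [sharpTerm, biPow_congr Λ r (isOpen_cone U) (h f) (h g) hz, toHolo_coe]

/-- The components for `k + l + m` and `k + (l + m)` are distinct types; the two bracketings are
compared in the common algebra `puncturedHolo`. -/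
theorem ofDegree_congr {i j : ℕ} (h : i = j) {x : H0 n (i : ℤ)} {y : H0 n (j : ℤ)}
    (hxy : toHolo n i x = toHolo n j y) : ofDegree n i x = ofDegree n j y := by
  subst h
  rw [toHolo_injective _ hxy]

theorem ofFormalDegree_congr {ν : FormalKind} {i j : ℕ} (h : i = j) {x : Formal ν (H0 n (i : ℤ))}
    {y : Formal ν (H0 n (j : ℤ))} (hxy : ∀ m, toHolo n i (x.1 m) = toHolo n j (y.1 m)) :
    ofFormalDegree n ν i x = ofFormalDegree n ν j y := by
  subst h
  congr 1
  ext1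
  funext m
  exact toHolo_injective _ (hxy m)

/-- The product `#` on formal global sections. -/
def sharpMul (Λ : Bivector n) (ν : FormalKind) :
    FormalSections n ν →ₗ[ℂ] FormalSections n ν →ₗ[ℂ] FormalSections n ν :=
  gradedMul (M := fun k : ℕ => Formal ν (H0 n (k : ℤ))) fun k l =>
    formalMul ν (sharpOp Λ k l) k (sharpOp_eq_zero Λ k l)

/-- The product `#` on global sections, with `μ` replaced by a scalar. -/
def sharpMulAt (Λ : Bivector n) (c : ℂ) : Sections n →ₗ[ℂ] Sections n →ₗ[ℂ] Sections n :=
  gradedMul (M := fun k : ℕ => H0 n (k : ℤ)) fun k l => scalarMul (sharpOp Λ k l) k c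

theorem sharpMul_lof (Λ : Bivector n) (ν : FormalKind) (k l : ℕ) (a : Formal ν (H0 n (k : ℤ)))
    (b : Formal ν (H0 n (l : ℤ))) :
    sharpMul Λ ν (ofFormalDegree n ν k a) (ofFormalDegree n ν l b) = ofFormalDegree n ν (k + l)
      (formalMul ν (sharpOp Λ k l) k (sharpOp_eq_zero Λ k l) a b) :=
  gradedMul_lof (M := fun k : ℕ => Formal ν (H0 n (k : ℤ))) _ k l a b

theorem sharpMulAt_lof (Λ : Bivector n) (c : ℂ) (k l : ℕ) (f : H0 n (k : ℤ)) (g : H0 n (l : ℤ)) :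
    sharpMulAt Λ c (ofDegree n k f) (ofDegree n l g) =
      ofDegree n (k + l) (scalarMul (sharpOp Λ k l) k c f g) :=
  gradedMul_lof (M := fun k : ℕ => H0 n (k : ℤ)) _ k l f g

theorem sharpOp_finite (Λ : Bivector n) {ν : FormalKind} {k l : ℕ} (a : Formal ν (H0 n (k : ℤ)))
    (b : Formal ν (H0 n (l : ℤ))) (m : ℤ) :
    (fun p : ℕ × ℤ => sharpOp Λ k l p.1 (a.1 p.2) (b.1 (m - p.1 - p.2))).HasFiniteSupport :=
  conv_finite a.2 b.2 (K := k) (fun r hr i j => by simp [sharpOp_eq_zero Λ k l r hr]) m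

theorem isSharp_sharpMul (Λ : Bivector n) (ν : FormalKind) : IsSharp Λ ν (sharpMul Λ ν) := by
  intro k l a b
  refine ⟨_, sharpMul_lof Λ ν k l a b, fun m U => ⟨?_, fun z hz => ?_⟩⟩
  · refine (sharpOp_finite Λ a b m).subset ?_
    rintro p ⟨z, hz, hp⟩ h
    rw [sharpTerm_res Λ k l _ _ _ U hz] at hp
    exact hp (congrFun (congrArg Subtype.val h) z)
  · simp only [sharpTerm_res Λ k l _ _ _ U hz]
    -- Evaluation at `z` is linear and so passes through the finite sum.
    exact linearMap_map_finsum ((LinearMap.proj (R := ℂ) (φ := fun _ : Coord n => ℂ) z).comp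
      (H0 n ((k + l : ℕ) : ℤ)).subtype) (sharpOp_finite Λ a b m)

theorem isSharpAt_sharpMulAt (Λ : Bivector n) (c : ℂ) : IsSharpAt Λ c (sharpMulAt Λ c) := by
  intro k l f g
  have h0 : ∀ r, k < r → sharpOp Λ k l r f g = 0 := fun r hr => by
    simp [sharpOp_eq_zero Λ k l r hr]
  refine ⟨_, sharpMulAt_lof Λ c k l f g, fun U => ⟨?_, fun z hz => ?_⟩⟩
  · refine (Set.finite_Iic k).subset ?_
    rintro r ⟨z, hz, hp⟩
    rw [sharpTerm_res Λ k l _ _ _ U hz] at hp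
    exact Set.mem_Iic.2 (not_lt.1 fun h => hp (by rw [h0 r h]; rfl))
  · simp only [sharpTerm_res Λ k l _ _ _ U hz]
    rw [scalarMul_apply (sharpOp_eq_zero Λ k l)]
    refine linearMap_map_finsum ((LinearMap.proj (R := ℂ) (φ := fun _ : Coord n => ℂ) z).comp
      (H0 n ((k + l : ℕ) : ℤ)).subtype) (f := fun r => c ^ r • sharpOp Λ k l r f g) ?_
    exact finite_support_of_imp (Set.finite_Iic k) fun r hr =>
      Set.mem_Iic.2 (not_lt.1 fun h => hr (by simp [h0 r h]))

theorem sum_coeff_mul_partialDer {Λ : Bivector n} (hskew : IsSkew Λ) (hjacobi : IsJacobi Λ)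
    (hrel : HasArrowRelation Λ) (a d e : Fin (n + 1)) :
    ∑ b, coeff Λ a b * partialDer b (coeff Λ d e) = 0 := by
  ext z
  by_cases hz : z = 0
  · simp [hz, partialDer_apply]
  · have h1 : ∀ b, (partialDer b (coeff Λ d e)).1 z = pd b (Λ d e).1 z := fun b =>
      partialDer_eqOn b _ hz
    have h2 : ∀ b, (coeff Λ a b).1 z = (Λ a b).1 z := fun b => rfl
    simpa [coeffDer, h1, h2] using coeffDer_eq_zero hskew hjacobi hrel a d e hz

theorem IsSkew.coeff_eq_neg {Λ : Bivector n} (h : IsSkew Λ) (a b : Fin (n + 1)) :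
    coeff Λ a b = -coeff Λ b a := by
  rw [coeff, h.apply_eq_neg, map_neg]; rfl

theorem starOp_coeff_assoc {Λ : Bivector n} (hskew : IsSkew Λ) (hjacobi : IsJacobi Λ)
    (hrel : HasArrowRelation Λ) (m : ℕ) (f g h : puncturedHolo n) :
    ∑ p ∈ Finset.HasAntidiagonal.antidiagonal m,
        starOp partialDer (coeff Λ) p.2 (starOp partialDer (coeff Λ) p.1 f g) h =
      ∑ p ∈ Finset.HasAntidiagonal.antidiagonal m,
        starOp partialDer (coeff Λ) p.2 f (starOp partialDer (coeff Λ) p.1 g h) := by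
  have hL := sum_coeff_mul_partialDer hskew hjacobi hrel
  have hL' : ∀ b d e, ∑ a, coeff Λ a b * partialDer a (coeff Λ d e) = 0 := fun b d e => by
    rw [Finset.sum_congr rfl fun a _ => by rw [hskew.coeff_eq_neg a b, neg_mul],
      Finset.sum_neg_distrib, hL, neg_zero]
  exact starOp_assoc (D := partialDer) (L := coeff Λ) partialDer_comm hL' hL m f g h

theorem toHolo_conv (Λ : Bivector n) {ν : FormalKind} {k l : ℕ} (a : Formal ν (H0 n (k : ℤ)))
    (b : Formal ν (H0 n (l : ℤ))) (m : ℤ) :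
    toHolo n _ (conv (sharpOp Λ k l) a.1 b.1 m) = conv (starOp partialDer (coeff Λ))
      (fun i => toHolo n k (a.1 i)) (fun i => toHolo n l (b.1 i)) m :=
  linearMap_map_finsum (toHolo n _) (sharpOp_finite Λ a b m)

theorem allows_support_toHolo {ν : FormalKind} {k : ℤ} (a : Formal ν (H0 n k)) :
    ν.Allows (Function.support fun i => toHolo n k (a.1 i)) :=
  FormalKind.Allows.mono a.2 fun i hi h => hi (by simp [h])

theorem sharpMul_assoc {Λ : Bivector n} (hskew : IsSkew Λ) (hjacobi : IsJacobi Λ)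
    (hrel : HasArrowRelation Λ) (ν : FormalKind) (x y w : FormalSections n ν) :
    sharpMul Λ ν (sharpMul Λ ν x y) w = sharpMul Λ ν x (sharpMul Λ ν y w) := by
  refine gradedMul_assoc (M := fun k : ℕ => Formal ν (H0 n (k : ℤ))) (fun k l m a b c => ?_) x y w
  refine ofFormalDegree_congr (add_assoc k l m) fun i => ?_
  simp only [formalMul_coe]
  have h1 := toHolo_conv Λ (formalMul ν (sharpOp Λ k l) k (sharpOp_eq_zero Λ k l) a b) c i
  have h2 := toHolo_conv Λ a (formalMul ν (sharpOp Λ l m) l (sharpOp_eq_zero Λ l m) b c) i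
  simp only [formalMul_coe, toHolo_conv] at h1 h2
  rw [h1, h2]
  -- `k + l` is the degree of the inner product `S r (a i) (b j)`, hence bounds the outer order, and
  -- it also dominates `k` and `l`.
  refine conv_assoc (starOp_coeff_assoc hskew hjacobi hrel) (K := k + l) (allows_support_toHolo a)
    (allows_support_toHolo b) (allows_support_toHolo c) ?_ ?_ ?_ i
  · exact fun r j u hr => starOp_left_eq_zero Λ (isHomog_toHolo _) (by omega) u
  · exact fun r j u hr => starOp_left_eq_zero Λ (isHomog_toHolo _) (by omega) u
  · exact fun r s j j' u hr => starOp_left_eq_zero Λ (k := k + l)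
      (by exact_mod_cast isHomog_starOp Λ r (isHomog_toHolo _) (isHomog_toHolo _)) hr u

theorem toHolo_scalarMul (Λ : Bivector n) (c : ℂ) (k l : ℕ) (f : H0 n (k : ℤ)) (g : H0 n (l : ℤ)) :
    toHolo n _ (scalarMul (sharpOp Λ k l) k c f g) =
      ∑ᶠ r, c ^ r • starOp partialDer (coeff Λ) r (toHolo n k f) (toHolo n l g) := by
  rw [scalarMul_apply (sharpOp_eq_zero Λ k l), linearMap_map_finsum]
  · simp only [map_smul, toHolo_sharpOp]
  · exact finite_support_of_imp (Set.finite_Iic k) fun r hr =>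
      Set.mem_Iic.2 (not_lt.1 fun h => hr (by simp [sharpOp_eq_zero Λ k l r h]))

theorem sharpMulAt_assoc {Λ : Bivector n} (hskew : IsSkew Λ) (hjacobi : IsJacobi Λ)
    (hrel : HasArrowRelation Λ) (c : ℂ) (x y w : Sections n) :
    sharpMulAt Λ c (sharpMulAt Λ c x y) w = sharpMulAt Λ c x (sharpMulAt Λ c y w) := by
  refine gradedMul_assoc (M := fun k : ℕ => H0 n (k : ℤ)) (fun k l m f g h => ?_) x y w
  refine ofDegree_congr (add_assoc k l m) ?_
  simp only [toHolo_scalarMul]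
  refine finsum_scalar_assoc (starOp_coeff_assoc hskew hjacobi hrel) (K := k + l) c _ ?_ ?_ ?_
  · exact fun r u hr => starOp_left_eq_zero Λ (isHomog_toHolo _) (by omega) u
  · exact fun r u hr => starOp_left_eq_zero Λ (isHomog_toHolo _) (by omega) u
  · exact fun r s u hr => starOp_left_eq_zero Λ (k := k + l)
      (by exact_mod_cast isHomog_starOp Λ r (isHomog_toHolo _) (isHomog_toHolo _)) hr u

theorem evalSections_lof (c : ℂ) (k : ℕ) (a : Formal .laurentPolynomial (H0 n (k : ℤ))) :
    evalSections n c (ofFormalDegree n .laurentPolynomial k a) =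
      ofDegree n k (evalMu c (H0 n (k : ℤ)) a) := by
  simp [evalSections]

theorem evalSections_sharpMul (Λ : Bivector n) {c : ℂ} (hc : c ≠ 0)
    (x y : FormalSections n .laurentPolynomial) :
    evalSections n c (sharpMul Λ .laurentPolynomial x y) =
      sharpMulAt Λ c (evalSections n c x) (evalSections n c y) := by
  induction x using DirectSum.induction_on with
  | zero => simp
  | add x x' hx hx' => simp only [map_add, LinearMap.add_apply, hx, hx']
  | of k x =>
  induction y using DirectSum.induction_on with
  | zero => simp
  | add y y' hy hy' => simp only [map_add, hy, hy']
  | of l y =>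
    simp only [← DirectSum.lof_eq_of ℂ]
    rw [sharpMul_lof, evalSections_lof, evalSections_lof, evalSections_lof, sharpMulAt_lof,
      evalMu_formalMul _ _ _ hc]

/-! ### Non-commutativity, seen on the coordinates. -/

theorem starOp_one_coordHolo (Λ : Bivector n) (a b : Fin (n + 1)) {z : Coord n} (hz : z ≠ 0) :
    (starOp partialDer (coeff Λ) 1 (coordHolo a) (coordHolo b)).1 z = 1 / 2 * (Λ a b).1 z := by
  have h : ∀ a i, (partialDer i (coordHolo a)).1 z = if a = i then 1 else 0 := fun a i => by
    rw [partialDer_eqOn i _ hz, pd_coordHolo]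
  simp [starOp, biOp_succ, h, coeff]

theorem ofDegree_injective (k : ℕ) : Function.Injective (ofDegree n k) :=
  DirectSum.of_injective (β := fun k : ℕ => H0 n (k : ℤ)) k

theorem ofFormalDegree_injective (ν : FormalKind) (k : ℕ) :
    Function.Injective (ofFormalDegree n ν k) :=
  DirectSum.of_injective (β := fun k : ℕ => Formal ν (H0 n (k : ℤ))) k

/-- The homogeneous coordinate `z_a` in the component of degree one of the direct sum. -/
def coordOne (n : ℕ) (a : Fin (n + 1)) : H0 n ((1 : ℕ) : ℤ) :=
  ofHolo ((1 : ℕ) : ℤ) (coordHolo a) (by simpa using isHomog_coordHolo a)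

theorem sharpOp_coordOne (Λ : Bivector n) (r : ℕ) (a b : Fin (n + 1)) {z : Coord n} (hz : z ≠ 0) :
    (sharpOp Λ 1 1 r (coordOne n a) (coordOne n b)).1 z =
      (starOp partialDer (coeff Λ) r (coordHolo a) (coordHolo b)).1 z := by
  have h : ∀ a, Set.EqOn (toHolo n _ (coordOne n a)).1 (coordHolo a).1 {0}ᶜ := fun a =>
    ofHolo_eqOn ((1 : ℕ) : ℤ) (coordHolo a) (by simpa using isHomog_coordHolo a)
  have hz' : z ∈ ({0}ᶜ : Set (Coord n)) := hz
  rw [← sharpTerm_eq_starOp Λ r (coordHolo a) (coordHolo b) hz',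
    ← toHolo_coe, toHolo_sharpOp, ← sharpTerm_eq_starOp Λ r _ _ hz']
  simp only [sharpTerm, biPow_congr Λ r isOpen_punctured (h a) (h b) hz']

theorem exists_apply_ne_zero {Λ : Bivector n} (hΛ : Λ ≠ 0) :
    ∃ a b z, z ≠ 0 ∧ (Λ a b).1 z ≠ 0 := by
  by_contra! h
  refine hΛ (funext fun a => funext fun b => Subtype.ext (funext fun z => ?_))
  by_cases hz : z = 0
  · rw [hz]; exact H0_apply_zero _
  · exact h a b z hz

theorem IsSkew.apply_swap {Λ : Bivector n} (h : IsSkew Λ) (a b : Fin (n + 1)) (z : Coord n) :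
    (Λ b a).1 z = -(Λ a b).1 z := by
  rw [h.apply_eq_neg b a]; rfl

theorem sharpMulAt_not_comm {Λ : Bivector n} (hskew : IsSkew Λ) (hΛ : Λ ≠ 0) {c : ℂ} (hc : c ≠ 0) :
    ∃ x y, sharpMulAt Λ c x y ≠ sharpMulAt Λ c y x := by
  obtain ⟨a, b, z, hz, hab⟩ := exists_apply_ne_zero hΛ
  refine ⟨ofDegree n 1 (coordOne n a), ofDegree n 1 (coordOne n b), fun h => hab ?_⟩
  rw [sharpMulAt_lof, sharpMulAt_lof] at h
  have h1 := congrFun (congrArg Subtype.val (ofDegree_injective _ h)) z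
  simp only [scalarMul, Finset.sum_range_succ, Finset.range_zero, Finset.sum_empty, zero_add,
    LinearMap.add_apply, LinearMap.smul_apply, Submodule.coe_add, Submodule.coe_smul, Pi.add_apply,
    Pi.smul_apply, sharpOp_coordOne Λ _ _ _ hz, starOp_one_coordHolo Λ _ _ hz, smul_eq_mul,
    hskew.apply_swap a b] at h1
  have h2 : ∀ a b : Fin (n + 1), (starOp partialDer (coeff Λ) 0 (coordHolo a) (coordHolo b)).1 z =
      z a * z b := fun a b => by simp [starOp, coordHolo]
  rw [h2, h2] at h1
  -- The order zero terms cancel, and order one gives `(c/2)(Λ^{ab} - Λ^{ba}) = c Λ^{ab}`; degree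
  -- one leaves no higher orders.
  have h3 : c * (Λ a b).1 z = 0 := by linear_combination h1
  exact (mul_eq_zero.1 h3).resolve_left hc

/-- A constant formal expression. -/
def constFormal (ν : FormalKind) {M : Type*} [AddCommGroup M] [Module ℂ M] (x : M) : Formal ν M :=
  ⟨Pi.single 0 x, by
    have h : Function.support (Pi.single 0 x : ℤ → M) ⊆ {0} := Pi.support_single_subset
    cases ν
    · exact (Set.finite_singleton 0).subset h
    · exact (bddAbove_singleton (a := (0 : ℤ))).mono h
    · exact (bddBelow_singleton (a := (0 : ℤ))).mono h⟩

theorem conv_constFormal {M N P : Type*} [AddCommGroup M] [Module ℂ M] [AddCommGroup N]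
    [Module ℂ N] [AddCommGroup P] [Module ℂ P] (T : ℕ → M →ₗ[ℂ] N →ₗ[ℂ] P) (ν : FormalKind)
    (x : M) (y : N) (r : ℕ) : conv T (constFormal ν x).1 (constFormal ν y).1 r = T r x y := by
  rw [conv, finsum_eq_single _ (r, 0)]
  · simp [constFormal]
  · rintro ⟨s, i⟩ hp
    by_cases hi : i = 0
    · subst hi
      have hs : (r : ℤ) - s ≠ 0 := fun h => hp (by ext <;> simp; omega)
      simp [constFormal, hs]
    · simp [constFormal, hi]

theorem sharpMul_not_comm {Λ : Bivector n} (hskew : IsSkew Λ) (hΛ : Λ ≠ 0) (ν : FormalKind) :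
    ∃ x y, sharpMul Λ ν x y ≠ sharpMul Λ ν y x := by
  obtain ⟨a, b, z, hz, hab⟩ := exists_apply_ne_zero hΛ
  refine ⟨ofFormalDegree n ν 1 (constFormal ν (coordOne n a)),
    ofFormalDegree n ν 1 (constFormal ν (coordOne n b)), fun h => hab ?_⟩
  rw [sharpMul_lof, sharpMul_lof] at h
  -- The coefficients of `μ^1` already differ, by `Λ^{ab}`.
  have h1 := congrFun (congrArg Subtype.val (ofFormalDegree_injective ν _ h)) ((1 : ℕ) : ℤ)
  rw [formalMul_coe, formalMul_coe, conv_constFormal, conv_constFormal] at h1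
  have h2 := congrFun (congrArg Subtype.val h1) z
  simp only [sharpOp_coordOne Λ _ _ _ hz, starOp_one_coordHolo Λ _ _ hz,
    hskew.apply_swap a b] at h2
  linear_combination h2

end SymbolCalculus

end

theorem theorem2 (n : ℕ) (Λ : SymbolCalculus.Bivector n)
    (hskew : SymbolCalculus.IsSkew Λ) (hjacobi : SymbolCalculus.IsJacobi Λ)
    (hrel : SymbolCalculus.HasArrowRelation Λ) :
    ∃ (sharp : ∀ ν : SymbolCalculus.FormalKind, SymbolCalculus.FormalSections n ν →ₗ[ℂ]
          SymbolCalculus.FormalSections n ν →ₗ[ℂ] SymbolCalculus.FormalSections n ν)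
      (sharpAt : ℂ → SymbolCalculus.Sections n →ₗ[ℂ]
          SymbolCalculus.Sections n →ₗ[ℂ] SymbolCalculus.Sections n),
      (∀ ν : SymbolCalculus.FormalKind,
        SymbolCalculus.IsSharp Λ ν (sharp ν) ∧
        (∀ x y w, sharp ν (sharp ν x y) w = sharp ν x (sharp ν y w)) ∧
        (Λ ≠ 0 → ∃ x y, sharp ν x y ≠ sharp ν y x)) ∧
      (∀ c : ℂ,
        SymbolCalculus.IsSharpAt Λ c (sharpAt c) ∧
        (∀ x y w, sharpAt c (sharpAt c x y) w = sharpAt c x (sharpAt c y w)) ∧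
        (Λ ≠ 0 → c ≠ 0 → ∃ x y, sharpAt c x y ≠ sharpAt c y x)) ∧
      (∀ c : ℂ, c ≠ 0 → ∀ x y,
        SymbolCalculus.evalSections n c (sharp .laurentPolynomial x y) =
          sharpAt c (SymbolCalculus.evalSections n c x) (SymbolCalculus.evalSections n c y)) := by
  refine ⟨SymbolCalculus.sharpMul Λ, SymbolCalculus.sharpMulAt Λ, fun ν => ⟨?_, ?_, ?_⟩,
    fun c => ⟨?_, ?_, ?_⟩, ?_⟩
  · exact SymbolCalculus.isSharp_sharpMul Λ ν
  · exact SymbolCalculus.sharpMul_assoc hskew hjacobi hrel ν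
  · exact fun hΛ => SymbolCalculus.sharpMul_not_comm hskew hΛ ν
  · exact SymbolCalculus.isSharpAt_sharpMulAt Λ c
  · exact SymbolCalculus.sharpMulAt_assoc hskew hjacobi hrel c
  · exact fun hΛ hc => SymbolCalculus.sharpMulAt_not_comm hskew hΛ hc
  · exact fun c hc => SymbolCalculus.evalSections_sharpMul Λ hc
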